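/- Let $H(\mathbb C)$ be the algebra of entire functions with pointwise operations and the topology of uniform convergence on compact sets. Let $\phi$ be a nonconstant entire function of exponential type, i.e. there are constants $A,B$ such that $|\phi(z)|\le A e^{B|z|}$ for all $z\in\mathbb C$, and let $\phi(D)$ be the continuous linear operator on $H(\mathbb C)$ given by $\phi(D)f=\sum_{n\ge 0}\frac{\phi^{(n)}(0)}{n!}f^{(n)}$. A vector $f\in H(\mathbb C)$ is hypercyclic for $\phi(D)$ if $\{\phi(D)^n f: n\ge 0\}$ is dense in $H(\mathbb C)$, and $\phi(D)$ supports a hypercyclic algebra if there is a nonzero (not necessarily unital) subalgebra of $H(\mathbb C)$ all of whose nonzero elements are hypercyclic for $\phi(D)$. 1. Assume that $|\phi(0)|<1$. Then $\phi(D)$ supports a hypercyclic algebra if and only if $\phi$ is not a multiple of an exponential function, i.e. is not of the form $z\mapsto c\,e^{az}$ with $a,c\in\mathbb C$. 2. Assume that $|\phi(0)|=1$ and that $\phi$ has subexponential growth, i.e. for every $\varepsilon>0$ there is a constant $C$ such that $|\phi(z)|\le C e^{\varepsilon|z|}$ for all $z\in\mathbb C$. If either $\phi'(0)\ne 0$ or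 $\phi$ has order less than $1/2$, i.e. $\limsup_{r\to\infty}\frac{\log\log M(r)}{\log r}<\frac12$ with $M(r)=\sup_{|z|=r}|\phi(z)|$, then $\phi(D)$ supports a hypercyclic algebra. -/

import Mathlib

open Filter Topology

/-- The algebra `H(ℂ)` of entire functions: a subalgebra of `C(ℂ, ℂ)`, with pointwise operations
and the topology induced by the compact-open topology (uniform convergence on compact sets). -/
def EntireFunctions : Subalgebra ℂ C(ℂ, ℂ) where
  carrier := {f | Differentiable ℂ (f : ℂ → ℂ)}
  mul_mem' := fun hf hg => Differentiable.mul hf hg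
  add_mem' := fun hf hg => Differentiable.add hf hg
  algebraMap_mem' := fun c => differentiable_const c

/-- `φ` is of exponential type: `|φ(z)| ≤ A exp(B|z|)` for some constants `A`, `B`. -/
def IsExponentialType (φ : ℂ → ℂ) : Prop :=
  ∃ A B : ℝ, ∀ z : ℂ, ‖φ z‖ ≤ A * Real.exp (B * ‖z‖)

/-- `φ` has subexponential growth: for each `ε > 0` there is `C` such that
`|φ(z)| ≤ C exp(ε|z|)` for all `z`. -/
def HasSubexponentialGrowth (φ : ℂ → ℂ) : Prop :=
  ∀ ε : ℝ, 0 < ε → ∃ C : ℝ, ∀ z : ℂ, ‖φ z‖ ≤ C * Real.exp (ε * ‖z‖)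

/-- The maximum modulus `M(r) = sup {|φ(z)| : |z| = r}`. -/
noncomputable def maxModulus (φ : ℂ → ℂ) (r : ℝ) : ℝ :=
  sSup ((fun z : ℂ => ‖φ z‖) '' Metric.sphere 0 r)

/-- The order `limsup_{r → ∞} log log M(r) / log r` of a nonconstant entire function. -/
noncomputable def entireOrder (φ : ℂ → ℂ) : EReal :=
  limsup (fun r : ℝ => ((Real.log (Real.log (maxModulus φ r)) / Real.log r : ℝ) : EReal)) atTop

/-- `φ` is a multiple of an exponential function: `φ(z) = c exp(az)` for some `a`, `c`. -/
def IsMultipleOfExponential (φ : ℂ → ℂ) : Prop :=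
  ∃ a c : ℂ, ∀ z : ℂ, φ z = c * Complex.exp (a * z)

/-- The `n`-th term `(φ⁽ⁿ⁾(0) / n!) f⁽ⁿ⁾(z)` of the series of `φ(D) f` at `z`. -/
noncomputable def convTerm (φ f : ℂ → ℂ) (n : ℕ) (z : ℂ) : ℂ :=
  iteratedDeriv n φ 0 / (n.factorial : ℂ) * iteratedDeriv n f z

theorem IsExponentialType.coeff_bound {φ : ℂ → ℂ} (hφ : Differentiable ℂ φ)
    (h : IsExponentialType φ) :
    ∃ A R : ℝ, 0 ≤ A ∧ 0 < R ∧ ∀ n : ℕ, ‖iteratedDeriv n φ 0‖ ≤ A * R ^ n := by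
  obtain ⟨A, B, h⟩ := h
  have hA : 0 ≤ A := by
    have := (norm_nonneg _).trans (h 0)
    simpa using this
  refine ⟨A * Real.exp B, Real.exp B, by positivity, Real.exp_pos _, fun n => ?_⟩
  have hr : (0 : ℝ) < n + 1 := by positivity
  have h1 := Complex.norm_iteratedDeriv_le_of_forall_mem_sphere_norm_le (f := φ) (c := 0)
    (C := A * Real.exp (B * (n + 1))) n hr hφ.diffContOnCl (fun z hz => by
      have := h z
      rwa [mem_sphere_zero_iff_norm.1 hz] at this)
  refine h1.trans ?_
  rw [div_le_iff₀ (by positivity)]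
  have h2 : (n.factorial : ℝ) ≤ ((n : ℝ) + 1) ^ n := by
    have : (n.factorial : ℝ) ≤ (n : ℝ) ^ n := by exact_mod_cast n.factorial_le_pow
    refine this.trans ?_
    gcongr
    linarith
  have h3 : Real.exp (B * (n + 1)) = Real.exp B * Real.exp B ^ n := by
    rw [← Real.exp_nat_mul, ← Real.exp_add]
    ring_nf
  rw [h3]
  calc (n.factorial : ℝ) * (A * (Real.exp B * Real.exp B ^ n))
      ≤ ((n : ℝ) + 1) ^ n * (A * (Real.exp B * Real.exp B ^ n)) := by gcongr
    _ = _ := by ring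

/-- Uniform bounds for the terms of the series, and hence for its sum, which only involve the values
of `f` on a disc of fixed radius. -/
theorem IsExponentialType.convTerm_bound {φ : ℂ → ℂ} (hφ : Differentiable ℂ φ)
    (h : IsExponentialType φ) :
    ∃ A R : ℝ, 0 ≤ A ∧ 0 < R ∧ ∀ (f : ℂ → ℂ), Differentiable ℂ f → ∀ (z : ℂ) (C : ℝ),
      (∀ w ∈ Metric.closedBall z R, ‖f w‖ ≤ C) →
      ∀ n : ℕ, ‖convTerm φ f n z‖ ≤ A * C * (1 / 2) ^ n := by
  obtain ⟨A, R, hA, hR, hn⟩ := h.coeff_bound hφ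
  refine ⟨A, 2 * R, hA, by positivity, fun f hf z C hC n => ?_⟩
  have h1 := Complex.norm_iteratedDeriv_le_of_forall_mem_sphere_norm_le (f := f) (c := z)
    (C := C) n (show 0 < 2 * R by positivity) hf.diffContOnCl
    (fun w hw => hC w (Metric.sphere_subset_closedBall hw))
  rw [convTerm, norm_mul, norm_div, Complex.norm_natCast]
  have hfac : (0 : ℝ) < n.factorial := by exact_mod_cast n.factorial_pos
  calc ‖iteratedDeriv n φ 0‖ / n.factorial * ‖iteratedDeriv n f z‖
      ≤ A * R ^ n / n.factorial * (n.factorial * C / (2 * R) ^ n) := by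
        gcongr
        exact hn n
    _ = A * C * (1 / 2) ^ n := by
        rw [mul_pow, div_pow, one_pow]
        field_simp

theorem exists_bound_closedBall {f : ℂ → ℂ} (hf : Continuous f) (z : ℂ) (R : ℝ) :
    ∃ C, ∀ w ∈ Metric.closedBall z R, ‖f w‖ ≤ C :=
  (isCompact_closedBall z R).exists_bound_of_continuousOn hf.continuousOn

theorem summable_convTerm {φ f : ℂ → ℂ} (hφ : Differentiable ℂ φ) (h : IsExponentialType φ)
    (hf : Differentiable ℂ f) (z : ℂ) : Summable fun n => convTerm φ f n z := by
  obtain ⟨A, R, -, -, hb⟩ := h.convTerm_bound hφ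
  obtain ⟨C, hC⟩ := exists_bound_closedBall hf.continuous z R
  exact Summable.of_norm_bounded (summable_geometric_two.mul_left (A * C)) (hb f hf z C hC)

theorem differentiable_tsum_convTerm {φ f : ℂ → ℂ} (hφ : Differentiable ℂ φ)
    (h : IsExponentialType φ) (hf : Differentiable ℂ f) :
    Differentiable ℂ fun z => ∑' n, convTerm φ f n z := by
  obtain ⟨A, R, -, hR, hb⟩ := h.convTerm_bound hφ
  intro z
  obtain ⟨C, hC⟩ := exists_bound_closedBall hf.continuous z (1 + R)
  have := Complex.differentiableOn_tsum_of_summable_norm (F := fun n z => convTerm φ f n z)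
    (summable_geometric_two.mul_left (A * C)) (U := Metric.ball z 1)
    (fun n => by
      have : ContDiff ℂ (n + 1 : ℕ) f := hf.contDiff
      have h2 : Differentiable ℂ (iteratedDeriv n f) :=
        this.differentiable_iteratedDeriv n (by exact_mod_cast Nat.lt_succ_self n)
      exact (h2.const_mul _).differentiableOn)
    Metric.isOpen_ball
    (fun n w hw => hb f hf w C (fun v hv => hC v (by
      rw [Metric.mem_closedBall] at hv ⊢
      have h3 : dist w z < 1 := hw
      linarith [dist_triangle v w z])) n)
  exact this.differentiableAt (Metric.ball_mem_nhds z one_pos)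

/-- The operator `φ(D) : f ↦ ∑ₙ (φ⁽ⁿ⁾(0) / n!) f⁽ⁿ⁾` on `H(ℂ)`, as a linear map. -/
noncomputable def convolutionLinearMap (φ : ℂ → ℂ) (hφ : Differentiable ℂ φ)
    (h : IsExponentialType φ) : EntireFunctions →ₗ[ℂ] EntireFunctions where
  toFun f := ⟨⟨fun z => ∑' n, convTerm φ f.1 n z,
    (differentiable_tsum_convTerm hφ h f.2).continuous⟩, differentiable_tsum_convTerm hφ h f.2⟩
  map_add' f g := by
    ext z
    change ∑' n, convTerm φ (⇑f.1 + ⇑g.1) n z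
      = ∑' n, convTerm φ f.1 n z + ∑' n, convTerm φ g.1 n z
    rw [← (summable_convTerm hφ h f.2 z).tsum_add (summable_convTerm hφ h g.2 z)]
    congr 1
    ext n
    rw [convTerm, iteratedDeriv_add (Differentiable.contDiff f.2).contDiffAt
      (Differentiable.contDiff g.2).contDiffAt, mul_add]
    rfl
  map_smul' c f := by
    ext z
    change ∑' n, convTerm φ (c • ⇑f.1) n z = c * ∑' n, convTerm φ f.1 n z
    rw [← tsum_mul_left]
    congr 1
    ext n
    rw [convTerm, iteratedDeriv_const_smul_field, convTerm, smul_eq_mul]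
    ring

theorem continuous_convolutionLinearMap (φ : ℂ → ℂ) (hφ : Differentiable ℂ φ)
    (h : IsExponentialType φ) : Continuous (convolutionLinearMap φ hφ h) := by
  obtain ⟨A, R, hA, hR, hb⟩ := h.convTerm_bound hφ
  rw [continuous_induced_rng, continuous_iff_continuousAt]
  intro f
  rw [ContinuousAt, ContinuousMap.tendsto_iff_forall_isCompact_tendstoUniformlyOn]
  intro K hK
  obtain ⟨r, hr⟩ := hK.isBounded.subset_closedBall 0
  have hf : Tendsto (fun g : EntireFunctions => g.1) (𝓝 f) (𝓝 f.1) :=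
    continuous_subtype_val.continuousAt
  rw [ContinuousMap.tendsto_iff_forall_isCompact_tendstoUniformlyOn] at hf
  have hf' := hf _ (isCompact_closedBall (0 : ℂ) (r + R))
  rw [Metric.tendstoUniformlyOn_iff] at hf' ⊢
  intro ε hε
  filter_upwards [hf' (ε / (2 * A + 1)) (by positivity)] with g hg z hz
  have hsub : ∀ w ∈ Metric.closedBall z R, ‖(f - g).1 w‖ ≤ ε / (2 * A + 1) := by
    intro w hw
    have hz' := hr hz
    rw [Metric.mem_closedBall] at hw hz'
    have := hg w (by
      rw [Metric.mem_closedBall]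
      linarith [dist_triangle w z 0])
    rw [dist_eq_norm] at this
    exact this.le
  have h1 := hb (f - g).1 (f - g).2 z _ hsub
  have h2 := tsum_of_norm_bounded (hasSum_geometric_two.mul_left (A * (ε / (2 * A + 1)))) h1
  have h3 : dist ((convolutionLinearMap φ hφ h f).1 z) ((convolutionLinearMap φ hφ h g).1 z)
      = ‖(convolutionLinearMap φ hφ h (f - g)).1 z‖ := by
    have h4 : convolutionLinearMap φ hφ h (f - g)
        = convolutionLinearMap φ hφ h f - convolutionLinearMap φ hφ h g :=
      map_sub (convolutionLinearMap φ hφ h) f g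
    rw [h4, dist_eq_norm]
    rfl
  change dist ((convolutionLinearMap φ hφ h f).1 z) ((convolutionLinearMap φ hφ h g).1 z) < ε
  rw [h3]
  refine lt_of_le_of_lt h2 ?_
  have : A * (ε / (2 * A + 1)) * 2 = ε * (2 * A) / (2 * A + 1) := by ring
  rw [this, div_lt_iff₀ (by positivity)]
  nlinarith

/-- The convolution operator `φ(D) : f ↦ ∑ₙ (φ⁽ⁿ⁾(0) / n!) f⁽ⁿ⁾` on `H(ℂ)`, for an entire function
`φ` of exponential type, as a continuous linear operator. -/
noncomputable def convolutionOperator (φ : ℂ → ℂ) (hφ : Differentiable ℂ φ)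
    (h : IsExponentialType φ) : EntireFunctions →L[ℂ] EntireFunctions :=
  ⟨convolutionLinearMap φ hφ h, continuous_convolutionLinearMap φ hφ h⟩

/-- The series defining `φ(D) f` converges at every point. -/
theorem hasSum_convolutionOperator (φ : ℂ → ℂ) (hφ : Differentiable ℂ φ)
    (h : IsExponentialType φ) (f : EntireFunctions) (z : ℂ) :
    HasSum (fun n : ℕ => iteratedDeriv n φ 0 / (n.factorial : ℂ) * iteratedDeriv n (⇑f.1) z)
      ((convolutionOperator φ hφ h f).1 z) :=
  (summable_convTerm hφ h f.2 z).hasSum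

/-- `x` is a hypercyclic vector for `T`: the orbit `{Tⁿ x : n ≥ 0}` is dense. -/
def IsHypercyclicVector {X : Type*} [TopologicalSpace X] [AddCommMonoid X] [Module ℂ X]
    (T : X →L[ℂ] X) (x : X) : Prop :=
  Dense (Set.range fun n : ℕ => (T ^ n) x)

/-- `T` supports a hypercyclic algebra: there is a nonzero (not necessarily unital) subalgebra of `X`
all of whose nonzero elements are hypercyclic vectors for `T`. -/
def SupportsHypercyclicAlgebra {X : Type*} [TopologicalSpace X] [Semiring X] [Algebra ℂ X]
    (T : X →L[ℂ] X) : Prop :=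
  ∃ A : NonUnitalSubalgebra ℂ X, A ≠ ⊥ ∧ ∀ x ∈ A, x ≠ 0 → IsHypercyclicVector T x

/-!
The hypercyclic algebra is generated by a single function `f`, found by a Baire category argument:
it is enough that for each degree `m`, any open sets `U`, `V` and any neighbourhood `W` of `0` there
are `u ∈ U` and `N` such that `φ(D)^N` sends `u, …, u ^ (m - 1)` into `W` and `u ^ m` into `V`
(`supportsHypercyclicAlgebra_of_forall_isOpen`). A nonzero polynomial in `f` without constant term
then behaves like its leading term along suitable iterates.

Such `u` are built from the eigenvectors `exp (γ z)`, with eigenvalue `φ γ`; those with `γ` in a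
segment span a dense subspace (`dense_span_expMul`). Take `∑ k_t exp (t w z)` in `U`, with small
`t > 0`, and `∑ l_s exp (λ_s z)` in `V`, and add to the former the correction
`∑ b_s θ_s ^ N exp (λ_s z / m)` with `b_s ^ m = l_s` and `θ_s ^ m = φ(λ_s)⁻¹`. In the expansion of
the powers the pure `m`-th powers of the correction reproduce the element of `V`. Every other
product tends to `0` if, for `λ_s` close to a point `w₁`,
* `|φ (t w)| < 1` for small `t > 0`,
* `|φ (r w₁ / m)| < |φ w₁| ^ (r / m)` for `1 ≤ r < m`,
* `log |φ|` is strictly convex on the segment containing the `λ_s`, and `|φ w₁| > 1`.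

All this can be achieved once there is a ray on which `|φ|` is initially less than `1` and later
exceeds `1` (`supportsHypercyclicAlgebra_of_ray`): the first maximum of `|φ (t w)| ^ (1 / t)` gives
the radial inequality (`exists_radial_lt`), which is an open condition for fixed `m`. As `φ` is not a
multiple of an exponential, `(φ'/φ)' ≠ 0` at some `w₁` nearby, and the harmonic function `log |φ|` is
then strictly convex in some direction through `w₁` (`exists_strictConvexOn_log_norm`).

If `|φ 0| < 1` such a ray exists by Liouville's theorem. If `|φ 0| = 1` it comes from the
Phragmén–Lindelöf principle: when `φ' 0 ≠ 0`, the modulus decreases initially along all rays of an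
open half plane, on which a function of subexponential growth cannot be bounded by `1`; when the
order is less than `1 / 2`, `φ` cannot even be bounded by `1` on a single ray of steepest descent.

Conversely, if `φ z = c exp (a z)`, then `φ(D)` is `c` times a translation, the orbit of a square
consists of squares, and these do not approximate `z` (`exists_le_norm_sub_sq`).
-/

/-! ### A Baire category criterion for hypercyclic algebras -/

/-- A condition on a single vector `f` guaranteeing that the algebra generated by `f` consists, up
to `0`, of hypercyclic vectors: for each degree `m`, the powers `f, …, f ^ (m - 1)` can be sent
to `0` along iterates of `T` that at the same time send `f ^ m` to any prescribed target. -/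
theorem supportsHypercyclicAlgebra_of_tendsto {X : Type*} [TopologicalSpace X] [Semiring X]
    [Algebra ℂ X] [IsTopologicalSemiring X] [ContinuousSMul ℂ X] [T2Space X] [Nontrivial X]
    (T : X →L[ℂ] X) (f : X)
    (h : ∀ m : ℕ, 1 ≤ m → ∀ v : X, ∃ N : ℕ → ℕ,
      (∀ n, 1 ≤ n → n < m → Tendsto (fun k => (T ^ N k) (f ^ n)) atTop (𝓝 0)) ∧
      Tendsto (fun k => (T ^ N k) (f ^ m)) atTop (𝓝 v)) :
    SupportsHypercyclicAlgebra T := by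
  let A : NonUnitalSubalgebra ℂ X :=
    { carrier := {x | ∃ P : Polynomial ℂ, P.coeff 0 = 0 ∧ Polynomial.aeval f P = x}
      add_mem' := by
        rintro _ _ ⟨P, hP, rfl⟩ ⟨Q, hQ, rfl⟩
        exact ⟨P + Q, by simp [hP, hQ], by simp⟩
      zero_mem' := ⟨0, by simp, by simp⟩
      mul_mem' := by
        rintro _ _ ⟨P, hP, rfl⟩ ⟨Q, hQ, rfl⟩
        exact ⟨P * Q, by simp [hP], by simp⟩
      smul_mem' := by
        rintro c _ ⟨P, hP, rfl⟩
        exact ⟨c • P, by simp [hP], by simp⟩ }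
  refine ⟨A, ?_, ?_⟩
  · have hfA : f ∈ A := ⟨Polynomial.X, by simp, by simp⟩
    intro hA
    rw [hA, NonUnitalAlgebra.mem_bot] at hfA
    obtain ⟨N, -, hN⟩ := h 1 le_rfl 1
    simp only [hfA, pow_one, map_zero] at hN
    exact zero_ne_one (tendsto_nhds_unique tendsto_const_nhds hN)
  · rintro x ⟨P, hP, rfl⟩ hx v
    have hP0 : P ≠ 0 := by
      rintro rfl
      simp at hx
    have hd : 1 ≤ P.natDegree := by
      by_contra! hd
      have : P.natDegree = 0 := by omega
      rw [Polynomial.eq_C_of_natDegree_eq_zero this, hP] at hP0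
      simp at hP0
    obtain ⟨N, hN, hN'⟩ := h P.natDegree hd (P.leadingCoeff⁻¹ • v)
    have key : Tendsto (fun k => (T ^ N k) (Polynomial.aeval f P)) atTop (𝓝 v) := by
      have h1 : Tendsto (fun k => ∑ i ∈ Finset.range P.natDegree,
          P.coeff i • (T ^ N k) (f ^ i) + P.leadingCoeff • (T ^ N k) (f ^ P.natDegree)) atTop
          (𝓝 (∑ i ∈ Finset.range P.natDegree, (0 : X)
            + P.leadingCoeff • (P.leadingCoeff⁻¹ • v))) := by
        refine (tendsto_finsetSum _ fun i hi => ?_).add (hN'.const_smul _)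
        rcases Nat.eq_zero_or_pos i with rfl | hi0
        · simp [hP]
        · simpa using (hN i hi0 (Finset.mem_range.1 hi)).const_smul (P.coeff i)
      rw [smul_inv_smul₀ (by simpa using hP0), Finset.sum_const_zero, zero_add] at h1
      refine h1.congr fun k => ?_
      rw [Polynomial.aeval_eq_sum_range, Finset.sum_range_succ, map_add, map_sum]
      simp only [map_smul, Polynomial.coeff_natDegree]
    exact mem_closure_of_tendsto key (Eventually.of_forall fun k => ⟨N k, rfl⟩)

/-- Baire category criterion: a generic `f` lies in all the dense open sets of those `u` for which
some `T ^ N` makes `u, …, u ^ (m - 1)` small and `u ^ m` close to a given target. -/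
theorem supportsHypercyclicAlgebra_of_forall_isOpen {X : Type*} [TopologicalSpace X] [Semiring X]
    [Algebra ℂ X] [IsTopologicalSemiring X] [ContinuousSMul ℂ X] [T2Space X] [Nontrivial X]
    [BaireSpace X] [SecondCountableTopology X] (T : X →L[ℂ] X)
    (h : ∀ m : ℕ, 1 ≤ m → ∀ U V W : Set X, IsOpen U → U.Nonempty → IsOpen V → V.Nonempty →
      IsOpen W → (0 : X) ∈ W → ∃ u ∈ U, ∃ N : ℕ,
        (∀ n, 1 ≤ n → n < m → (T ^ N) (u ^ n) ∈ W) ∧ (T ^ N) (u ^ m) ∈ V) :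
    SupportsHypercyclicAlgebra T := by
  let B := TopologicalSpace.countableBasis X
  have hB : TopologicalSpace.IsTopologicalBasis B := TopologicalSpace.isBasis_countableBasis X
  have : Countable B := TopologicalSpace.countable_countableBasis X
  let ι := {i : ℕ × B × B // 1 ≤ i.1 ∧ (0 : X) ∈ (i.2.2 : Set X)}
  let O : ι → Set X := fun i => ⋃ N : ℕ,
    (⋂ n ∈ Finset.Ico 1 i.1.1, {u | (T ^ N) (u ^ n) ∈ (i.1.2.2 : Set X)}) ∩
      {u | (T ^ N) (u ^ i.1.1) ∈ (i.1.2.1 : Set X)}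
  have hO : ∀ i, IsOpen (O i) := by
    intro i
    refine isOpen_iUnion fun N => IsOpen.inter (isOpen_biInter_finset fun n _ => ?_) ?_
    · exact (hB.isOpen i.1.2.2.2).preimage ((T ^ N).continuous.comp (continuous_pow n))
    · exact (hB.isOpen i.1.2.1.2).preimage ((T ^ N).continuous.comp (continuous_pow _))
  have hOd : ∀ i, Dense (O i) := by
    rintro ⟨⟨m, V, W⟩, hm, hW⟩
    rw [dense_iff_inter_open]
    intro U hU hUne
    obtain ⟨u, hu, N, h1, h2⟩ := h m hm U V W hU hUne (hB.isOpen V.2)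
      (TopologicalSpace.nonempty_of_mem_countableBasis V.2) (hB.isOpen W.2) hW
    refine ⟨u, hu, Set.mem_iUnion.2 ⟨N, Set.mem_iInter₂.2 fun n hn => ?_, h2⟩⟩
    rw [Finset.mem_Ico] at hn
    exact h1 n hn.1 hn.2
  obtain ⟨f, hf⟩ := (dense_iInter_of_isOpen hO hOd).nonempty
  rw [Set.mem_iInter] at hf
  refine supportsHypercyclicAlgebra_of_tendsto T f fun m hm v => ?_
  obtain ⟨V, hV⟩ := (𝓝 v).exists_antitone_basis
  obtain ⟨W, hW⟩ := (𝓝 (0 : X)).exists_antitone_basis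
  have : ∀ k, ∃ N : ℕ, (∀ n, 1 ≤ n → n < m → (T ^ N) (f ^ n) ∈ W k) ∧ (T ^ N) (f ^ m) ∈ V k := by
    intro k
    obtain ⟨V', hV'B, hvV', hV'⟩ := hB.mem_nhds_iff.1 (hV.mem k)
    obtain ⟨W', hW'B, hvW', hW'⟩ := hB.mem_nhds_iff.1 (hW.mem k)
    obtain ⟨N, hN1, hN2⟩ := Set.mem_iUnion.1 (hf ⟨⟨m, ⟨V', hV'B⟩, ⟨W', hW'B⟩⟩, hm, hvW'⟩)
    refine ⟨N, fun n h1 h2 => hW' ?_, hV' hN2⟩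
    exact Set.mem_iInter₂.1 hN1 n (Finset.mem_Ico.2 ⟨h1, h2⟩)
  choose N hN using this
  exact ⟨N, fun n h1 h2 => hW.tendsto fun k => (hN k).1 n h1 h2, hV.tendsto fun k => (hN k).2⟩

/-! ### The space of entire functions -/

instance : SecondCountableTopology EntireFunctions :=
  TopologicalSpace.Subtype.secondCountableTopology (EntireFunctions : Set C(ℂ, ℂ))


theorem isClosed_entireFunctions : IsClosed (EntireFunctions : Set C(ℂ, ℂ)) := by
  rw [isClosed_iff_clusterPt]
  intro f hf
  rw [clusterPt_iff_ultrafilter] at hf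
  obtain ⟨u, hu, huf⟩ := hf
  have h1 : Tendsto (fun g : C(ℂ, ℂ) => g) u (𝓝 f) := huf
  rw [ContinuousMap.tendsto_iff_tendstoLocallyUniformly, ← tendstoLocallyUniformlyOn_univ] at h1
  have h2 := h1.differentiableOn (by
    filter_upwards [le_principal_iff.1 hu] with g hg
    exact Differentiable.differentiableOn hg) isOpen_univ
  exact differentiableOn_univ.1 h2

instance : BaireSpace EntireFunctions := by
  have : CompleteSpace (EntireFunctions : Set C(ℂ, ℂ)) :=
    isClosed_entireFunctions.completeSpace_coe
  have : (uniformity (EntireFunctions : Set C(ℂ, ℂ))).IsCountablyGenerated :=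
    Filter.comap.isCountablyGenerated _ _
  exact inferInstanceAs (BaireSpace (EntireFunctions : Set C(ℂ, ℂ)))

theorem EntireFunctions.tendsto_iff {ι : Type*} {l : Filter ι} {F : ι → EntireFunctions}
    {f : EntireFunctions} :
    Tendsto F l (𝓝 f) ↔ ∀ R ε : ℝ, 0 < ε → ∀ᶠ i in l, ∀ z : ℂ, ‖z‖ ≤ R → ‖f.1 z - (F i).1 z‖ < ε := by
  rw [tendsto_subtype_rng, ContinuousMap.tendsto_iff_forall_isCompact_tendstoUniformlyOn]
  simp only [Metric.tendstoUniformlyOn_iff]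
  constructor
  · intro h R ε hε
    filter_upwards [h _ (isCompact_closedBall (0 : ℂ) R) ε hε] with i hi z hz
    simpa [dist_eq_norm] using hi z (by simpa using hz)
  · intro h K hK ε hε
    obtain ⟨R, hR⟩ := hK.isBounded.subset_closedBall 0
    filter_upwards [h R ε hε] with i hi z hz
    simpa [dist_eq_norm] using hi z (by simpa using hR hz)

/-! ### Exponentials and convolution operators -/

/-- The exponential `z ↦ exp (γ z)` as an entire function. -/
noncomputable def expMul (γ : ℂ) : EntireFunctions :=
  ⟨⟨fun z => Complex.exp (γ * z), by fun_prop⟩, by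
    change Differentiable ℂ fun z => Complex.exp (γ * z)
    fun_prop⟩

theorem EntireFunctions.ext_apply {f g : EntireFunctions} (h : ∀ z, f.1 z = g.1 z) : f = g :=
  Subtype.ext (ContinuousMap.ext h)

theorem expMul_add (γ δ : ℂ) : expMul (γ + δ) = expMul γ * expMul δ :=
  EntireFunctions.ext_apply fun z => by
    change Complex.exp ((γ + δ) * z) = Complex.exp (γ * z) * Complex.exp (δ * z)
    rw [add_mul, Complex.exp_add]

theorem expMul_zero : expMul 0 = 1 :=
  EntireFunctions.ext_apply fun z => by
    change Complex.exp (0 * z) = 1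
    simp

theorem prod_expMul {ι : Type*} (s : Finset ι) (γ : ι → ℂ) :
    ∏ i ∈ s, expMul (γ i) = expMul (∑ i ∈ s, γ i) := by
  classical
  induction s using Finset.induction_on with
  | empty => simp [expMul_zero]
  | insert a s ha ih => rw [Finset.prod_insert ha, Finset.sum_insert ha, expMul_add, ih]

theorem convolutionOperator_expMul (φ : ℂ → ℂ) (hφ : Differentiable ℂ φ)
    (h : IsExponentialType φ) (γ : ℂ) :
    convolutionOperator φ hφ h (expMul γ) = φ γ • expMul γ := by
  refine EntireFunctions.ext_apply fun z => ?_
  have h1 := hasSum_convolutionOperator φ hφ h (expMul γ) z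
  have h2 := (Complex.hasSum_taylorSeries_of_entire hφ 0 γ).mul_right (Complex.exp (γ * z))
  have h3 : ∀ n : ℕ, iteratedDeriv n φ 0 / (n.factorial : ℂ) * iteratedDeriv n (expMul γ).1 z
      = (n.factorial : ℂ)⁻¹ • (γ - 0) ^ n • iteratedDeriv n φ 0 * Complex.exp (γ * z) := by
    intro n
    have h4 : iteratedDeriv n (expMul γ).1 z = γ ^ n * Complex.exp (γ * z) :=
      congrFun (iteratedDeriv_cexp_const_mul n γ) z
    rw [h4]
    simp only [smul_eq_mul, sub_zero]
    ring
  simp only [h3] at h1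
  exact h1.unique h2

theorem convolutionOperator_pow_expMul (φ : ℂ → ℂ) (hφ : Differentiable ℂ φ)
    (h : IsExponentialType φ) (γ : ℂ) (N : ℕ) :
    (convolutionOperator φ hφ h ^ N) (expMul γ) = φ γ ^ N • expMul γ := by
  induction N with
  | zero => simp
  | succ N ih =>
    rw [pow_succ', mul_apply_eq_comp, ih, map_smul, convolutionOperator_expMul,
      smul_smul, pow_succ]

/-- The entire function `z ↦ z`. -/
noncomputable def coordinate : EntireFunctions :=
  ⟨⟨fun z => z, continuous_id⟩, differentiable_id⟩

theorem tendsto_slope_expMul (e : ℂ) :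
    Tendsto (fun h : ℝ => (h : ℂ)⁻¹ • (expMul (h * e) + (-1 : ℂ) • 1)) (𝓝[≠] 0) (𝓝 (e • coordinate)) := by
  rw [EntireFunctions.tendsto_iff]
  intro R ε hε
  have hlim : Tendsto (fun h : ℝ => |h| * (‖e‖ * |R|) ^ 2) (𝓝[≠] 0) (𝓝 0) := by
    have : Continuous fun h : ℝ => |h| * (‖e‖ * |R|) ^ 2 := by fun_prop
    simpa using (this.tendsto 0).mono_left nhdsWithin_le_nhds
  have hlim2 : Tendsto (fun h : ℝ => |h| * (‖e‖ * |R|)) (𝓝[≠] 0) (𝓝 0) := by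
    have : Continuous fun h : ℝ => |h| * (‖e‖ * |R|) := by fun_prop
    simpa using (this.tendsto 0).mono_left nhdsWithin_le_nhds
  filter_upwards [hlim.eventually (gt_mem_nhds hε), hlim2.eventually (gt_mem_nhds one_pos),
    self_mem_nhdsWithin] with h h1 h2 h0 z hz
  have h0' : (h : ℂ) ≠ 0 := by exact_mod_cast h0
  have hz' : ‖z‖ ≤ |R| := hz.trans (le_abs_self R)
  have hb : ‖(h : ℂ) * e * z‖ ≤ |h| * (‖e‖ * |R|) := by
    rw [norm_mul, norm_mul, Complex.norm_real, Real.norm_eq_abs, mul_assoc]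
    gcongr
  have h3 := Complex.norm_exp_sub_one_sub_id_le (hb.trans h2.le)
  change ‖e * z - (h : ℂ)⁻¹ * (Complex.exp (h * e * z) + (-1) * 1)‖ < ε
  have h4 : e * z - (h : ℂ)⁻¹ * (Complex.exp (h * e * z) + (-1) * 1)
      = -((h : ℂ)⁻¹ * (Complex.exp (h * e * z) - 1 - h * e * z)) := by
    field_simp
    ring
  have hpos : 0 < |h| := abs_pos.2 h0
  rw [h4, norm_neg, norm_mul, norm_inv, Complex.norm_real, Real.norm_eq_abs]
  calc |h|⁻¹ * ‖Complex.exp (h * e * z) - 1 - h * e * z‖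
      ≤ |h|⁻¹ * (|h| * (‖e‖ * |R|)) ^ 2 := by
        gcongr
        exact h3.trans (by gcongr)
    _ = |h| * (‖e‖ * |R|) ^ 2 := by field_simp
    _ < ε := h1

theorem tendsto_taylorSum (g : EntireFunctions) :
    Tendsto (fun n : ℕ => ∑ k ∈ Finset.range n,
      ((k.factorial : ℂ)⁻¹ * iteratedDeriv k g.1 0) • coordinate ^ k) atTop (𝓝 g) := by
  rw [EntireFunctions.tendsto_iff]
  intro R ε hε
  have hg : Differentiable ℂ g.1 := g.2
  have hr : (0 : ℝ) < 2 * (|R| + 1) := by positivity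
  obtain ⟨C, hC⟩ := exists_bound_closedBall hg.continuous 0 (2 * (|R| + 1))
  have hT := Complex.hasSum_taylorSeries_of_entire hg 0
  have hC0 : 0 ≤ C := (norm_nonneg _).trans (hC 0 (by simp; positivity))
  have hbound : ∀ (n : ℕ) (z : ℂ), z ∈ Metric.closedBall (0 : ℂ) R →
      ‖((n.factorial : ℂ)⁻¹ * iteratedDeriv n g.1 0) * z ^ n‖ ≤ C * (1 / 2) ^ n := by
    intro n z hz
    have hz' : ‖z‖ ≤ |R| + 1 := by
      rw [mem_closedBall_zero_iff] at hz
      linarith [le_abs_self R]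
    have h1 := Complex.norm_iteratedDeriv_le_of_forall_mem_sphere_norm_le (f := g.1) (c := 0)
      (C := C) n hr hg.diffContOnCl (fun w hw => hC w (Metric.sphere_subset_closedBall hw))
    have hfac : (0 : ℝ) < n.factorial := by exact_mod_cast n.factorial_pos
    rw [norm_mul, norm_mul, norm_inv, norm_pow, Complex.norm_natCast]
    calc (n.factorial : ℝ)⁻¹ * ‖iteratedDeriv n g.1 0‖ * ‖z‖ ^ n
        ≤ (n.factorial : ℝ)⁻¹ * (n.factorial * C / (2 * (|R| + 1)) ^ n) * (|R| + 1) ^ n := by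
          gcongr
      _ = C * (1 / 2) ^ n := by
          rw [mul_pow, div_pow, one_pow]
          field_simp
  have hunif := tendstoUniformlyOn_tsum_nat (summable_geometric_two.mul_left C) hbound
  filter_upwards [Metric.tendstoUniformlyOn_iff.1 hunif ε hε] with n hn z hz
  have h2 := hn z (mem_closedBall_zero_iff.2 hz)
  rw [dist_eq_norm] at h2
  have h3 : g.1 z = ∑' n : ℕ, ((n.factorial : ℂ)⁻¹ * iteratedDeriv n g.1 0) * z ^ n := by
    rw [← (hT z).tsum_eq]
    refine tsum_congr fun n => ?_
    simp only [smul_eq_mul, sub_zero]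
    ring
  have h4 : (∑ k ∈ Finset.range n,
      ((k.factorial : ℂ)⁻¹ * iteratedDeriv k g.1 0) • coordinate ^ k : EntireFunctions).1 z
      = ∑ k ∈ Finset.range n, ((k.factorial : ℂ)⁻¹ * iteratedDeriv k g.1 0) * z ^ k := by
    simp only [AddSubmonoidClass.coe_finsetSum, ContinuousMap.coe_sum, Finset.sum_apply]
    rfl
  rw [h3, h4]
  exact h2

/-- The exponentials whose frequencies run over a segment span a dense subspace: differentiating
with respect to the frequency puts all products of a monomial and an exponential in the closure,
and Taylor expansion then gives all entire functions. -/
theorem dense_span_expMul (a b : ℝ) (hab : a < b) (c e : ℂ) (he : e ≠ 0) :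
    Dense (Submodule.span ℂ ((fun t : ℝ => expMul (c + t * e)) '' Set.Ioo a b) :
      Set EntireFunctions) := by
  set S := (Submodule.span ℂ ((fun t : ℝ => expMul (c + t * e)) '' Set.Ioo a b)).topologicalClosure
    with hS
  have hclosed : IsClosed (S : Set EntireFunctions) := Submodule.isClosed_topologicalClosure _
  have hmono : ∀ n : ℕ, ∀ t ∈ Set.Ioo a b, coordinate ^ n * expMul (c + t * e) ∈ S := by
    intro n
    induction n with
    | zero =>
      intro t ht
      rw [pow_zero, one_mul]
      exact Submodule.le_topologicalClosure _ (Submodule.subset_span ⟨t, ht, rfl⟩)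
    | succ n ih =>
      intro t ht
      have h1 := ((tendsto_slope_expMul e).const_mul
        (coordinate ^ n * expMul (c + t * e))).const_smul e⁻¹
      have h2 : e⁻¹ • (coordinate ^ n * expMul (c + t * e) * (e • coordinate))
          = coordinate ^ (n + 1) * expMul (c + t * e) := by
        rw [mul_smul_comm, inv_smul_smul₀ he, pow_succ]
        ring
      rw [h2] at h1
      refine hclosed.mem_of_tendsto h1 ?_
      have hev : ∀ᶠ h : ℝ in 𝓝[≠] 0, t + h ∈ Set.Ioo a b := by
        have : Tendsto (fun h : ℝ => t + h) (𝓝[≠] 0) (𝓝 t) := by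
          simpa using ((continuous_const_add t).tendsto 0).mono_left nhdsWithin_le_nhds
        exact this.eventually (isOpen_Ioo.mem_nhds ht)
      filter_upwards [hev] with h hh
      refine S.smul_mem _ ?_
      rw [mul_smul_comm]
      refine S.smul_mem _ ?_
      have h3 : c + (t + h : ℝ) * e = (c + t * e) + h * e := by
        push_cast
        ring
      rw [mul_add, mul_assoc, ← expMul_add, ← h3, mul_smul_comm, mul_one]
      exact S.add_mem (ih _ hh) (S.smul_mem _ (ih _ ht))
  have hall : ∀ f : EntireFunctions, f ∈ S := by
    intro f
    obtain ⟨t, ht⟩ := Set.nonempty_Ioo.2 hab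
    set γ := c + t * e
    -- approximate `f exp (-γ z)` by its Taylor polynomials
    set g : EntireFunctions := f * expMul (-γ) with hg
    have hfg : f = g * expMul γ := by
      rw [hg, mul_assoc, ← expMul_add]
      simp [expMul_zero]
    have hsum : Tendsto (fun n : ℕ => ∑ k ∈ Finset.range n,
        ((k.factorial : ℂ)⁻¹ * iteratedDeriv k g.1 0) • coordinate ^ k) atTop (𝓝 g) := by
      exact tendsto_taylorSum g
    rw [hfg]
    refine hclosed.mem_of_tendsto (hsum.mul_const (expMul γ)) (Eventually.of_forall fun n => ?_)
    rw [Finset.sum_mul]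
    refine S.sum_mem fun k _ => ?_
    rw [smul_mul_assoc]
    exact S.smul_mem _ (hmono k t ht)
  intro f
  exact hall f

/-! ### Finite sums of exponentials -/

theorem exists_sum_expMul_mem {a b : ℝ} (hab : a < b) (c : ℂ) {e : ℂ} (he : e ≠ 0)
    {U : Set EntireFunctions} (hU : IsOpen U) (hne : U.Nonempty) :
    ∃ (s : Finset ℝ) (k : ℝ → ℂ), (∀ t ∈ s, t ∈ Set.Ioo a b) ∧
      ∑ t ∈ s, k t • expMul (c + t * e) ∈ U := by
  obtain ⟨f, hfU, hf⟩ := (dense_span_expMul a b hab c e he).inter_open_nonempty U hU hne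
  obtain ⟨l, hl, rfl⟩ := (Finsupp.mem_span_image_iff_linearCombination ℂ).1 hf
  exact ⟨l.support, l, fun t ht => hl ht, hfU⟩

/-- The family `∑ i, a i θ i ^ N exp (γ i z)`, indexed by `N`. -/
noncomputable def expSum {ι : Type*} [Fintype ι] (γ θ a : ι → ℂ) (N : ℕ) : EntireFunctions :=
  ∑ i, (a i * θ i ^ N) • expMul (γ i)

theorem tendsto_expSum {ι : Type*} [Fintype ι] (γ θ a : ι → ℂ) (S : Finset ι)
    (h1 : ∀ i ∈ S, θ i = 1) (h2 : ∀ i ∉ S, ‖θ i‖ < 1) :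
    Tendsto (expSum γ θ a) atTop (𝓝 (∑ i ∈ S, a i • expMul (γ i))) := by
  classical
  have h3 : ∑ i ∈ S, a i • expMul (γ i) = ∑ i, (if i ∈ S then a i else 0) • expMul (γ i) := by
    simp only [ite_smul, zero_smul]
    rw [Finset.sum_ite_mem, Finset.univ_inter]
  rw [h3]
  refine tendsto_finsetSum _ fun i _ => Tendsto.smul ?_ tendsto_const_nhds
  by_cases hi : i ∈ S
  · simp [hi, h1 i hi]
  · simpa [hi] using (tendsto_pow_atTop_nhds_zero_of_norm_lt_one (h2 i hi)).const_mul (a i)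

/-- The powers of an `expSum` are again of this form after applying the iterates of `φ(D)`. Only
the products of exponentials for which the growth factor `φ (∑ γ) ∏ θ` has modulus at least `1`
matter in the limit. -/
theorem pow_convolutionOperator_expSum_pow (φ : ℂ → ℂ) (hφ : Differentiable ℂ φ)
    (h : IsExponentialType φ) {ι : Type*} [Fintype ι] (γ θ a : ι → ℂ) (n N : ℕ) :
    (convolutionOperator φ hφ h ^ N) (expSum γ θ a N ^ n)
      = expSum (fun p : Fin n → ι => ∑ i, γ (p i))
        (fun p => φ (∑ i, γ (p i)) * ∏ i, θ (p i)) (fun p => ∏ i, a (p i)) N := by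
  rw [expSum, Fintype.sum_pow, map_sum]
  refine Finset.sum_congr rfl fun p _ => ?_
  rw [Finset.prod_smul, prod_expMul, map_smul, convolutionOperator_pow_expMul, smul_smul,
    Finset.prod_mul_distrib, Finset.prod_pow, mul_pow]
  congr 1
  ring

/-! ### Convexity of `log |φ|` along segments -/

theorem hasDerivAt_log_norm_comp_line {φ : ℂ → ℂ} (hφ : Differentiable ℂ φ) (w e : ℂ) (s : ℝ)
    (h0 : φ (w + s * e) ≠ 0) :
    HasDerivAt (fun s : ℝ => Real.log ‖φ (w + s * e)‖)
      (e * (deriv φ (w + s * e) / φ (w + s * e))).re s := by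
  have h1 : HasDerivAt (fun s : ℝ => w + s * e) e s := by
    simpa using (Complex.ofRealCLM.hasDerivAt.mul_const e).const_add w
  have h2 : HasDerivAt (fun s : ℝ => φ (w + s * e)) (deriv φ (w + s * e) * e) s :=
    (hφ _).hasDerivAt.comp s h1
  have h3 := (h2.norm_sq.log (by positivity)).const_mul (1 / 2 : ℝ)
  have h4 : (fun s : ℝ => Real.log ‖φ (w + s * e)‖)
      = fun s : ℝ => 1 / 2 * Real.log (‖φ (w + s * e)‖ ^ 2) := by
    ext s
    rw [Real.log_pow]
    push_cast
    ring
  have h5 : (e * (deriv φ (w + s * e) / φ (w + s * e)))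
      = ((Complex.normSq (φ (w + s * e)))⁻¹ : ℝ) *
        ((starRingEnd ℂ) (φ (w + s * e)) * (deriv φ (w + s * e) * e)) := by
    rw [div_eq_mul_inv, Complex.inv_def]
    ring
  have h6 : (e * (deriv φ (w + s * e) / φ (w + s * e))).re
      = 1 / 2 * (2 * inner ℝ (φ (w + s * e)) (deriv φ (w + s * e) * e)
        / ‖φ (w + s * e)‖ ^ 2) := by
    rw [h5, Complex.re_ofReal_mul, Complex.inner, ← Complex.normSq_eq_norm_sq,
      mul_comm (starRingEnd ℂ _)]
    ring
  rw [h4, h6]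
  exact h3

/-- If `(φ'/φ)' ≠ 0` at `w`, then the harmonic function `log |φ|` is strictly convex along a short
segment through `w`, in a suitable direction. -/
theorem exists_strictConvexOn_log_norm {φ : ℂ → ℂ} (hφ : Differentiable ℂ φ) {w : ℂ}
    (hw : φ w ≠ 0) (hd : deriv (fun z => deriv φ z / φ z) w ≠ 0) :
    ∃ e : ℂ, e ≠ 0 ∧ ∃ η : ℝ, 0 < η ∧
      StrictConvexOn ℝ (Set.Ioo (-η) η) fun s : ℝ => Real.log ‖φ (w + s * e)‖ := by
  set q : ℂ → ℂ := fun z => deriv φ z / φ z with hq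
  -- in this direction the second derivative `Re (e ^ 2 q')` of `log |φ|` is `|q'| ^ 2 > 0` at `w`
  obtain ⟨e, he⟩ := IsAlgClosed.exists_pow_nat_eq ((starRingEnd ℂ) (deriv q w)) two_pos
  have he0 : e ≠ 0 := by
    rintro rfl
    rw [zero_pow two_ne_zero, eq_comm, map_eq_zero] at he
    exact hd he
  have hqa : AnalyticAt ℂ q w := (hφ.analyticAt w).deriv.div (hφ.analyticAt w) hw
  have hline : Tendsto (fun s : ℝ => w + s * e) (𝓝 0) (𝓝 w) := by
    have : Continuous fun s : ℝ => w + s * e := by fun_prop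
    simpa using this.tendsto 0
  have hpos : 0 < (e ^ 2 * deriv q w).re := by
    rw [he, ← Complex.normSq_eq_conj_mul_self, Complex.ofReal_re]
    exact Complex.normSq_pos.2 hd
  have hcont : ContinuousAt (fun z => (e ^ 2 * deriv q z).re) w :=
    Complex.continuous_re.continuousAt.comp (hqa.deriv.continuousAt.const_mul _)
  have hev : ∀ᶠ z in 𝓝 w, φ z ≠ 0 ∧ DifferentiableAt ℂ q z ∧ 0 < (e ^ 2 * deriv q z).re :=
    (hφ.continuous.continuousAt.eventually_ne hw).and
      ((hqa.eventually_analyticAt.mono fun z hz => hz.differentiableAt).and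
        (hcont.eventually (lt_mem_nhds hpos)))
  obtain ⟨η, hη, hball⟩ := Metric.eventually_nhds_iff.1 (hline.eventually hev)
  have hI : ∀ s ∈ Set.Ioo (-η) η, φ (w + s * e) ≠ 0 ∧ DifferentiableAt ℂ q (w + s * e) ∧
      0 < (e ^ 2 * deriv q (w + s * e)).re := fun s hs =>
    hball (by rw [dist_zero_right, Real.norm_eq_abs]; exact abs_lt.2 hs)
  have hF : ∀ s ∈ Set.Ioo (-η) η, HasDerivAt (fun s : ℝ => Real.log ‖φ (w + s * e)‖)
      (e * q (w + s * e)).re s := fun s hs => hasDerivAt_log_norm_comp_line hφ w e s (hI s hs).1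
  have hG : ∀ s ∈ Set.Ioo (-η) η, HasDerivAt (fun s : ℝ => (e * q (w + s * e)).re)
      (e ^ 2 * deriv q (w + s * e)).re s := by
    intro s hs
    have h1 : HasDerivAt (fun s : ℝ => w + s * e) e s := by
      simpa using (Complex.ofRealCLM.hasDerivAt.mul_const e).const_add w
    have h2 : HasDerivAt (fun s : ℝ => q (w + s * e)) (deriv q (w + s * e) * e) s :=
      HasDerivAt.comp (h₂ := q) s (hI s hs).2.1.hasDerivAt h1
    have h3 := Complex.reCLM.hasFDerivAt.comp_hasDerivAt s (h2.const_mul e)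
    have h4 : e ^ 2 * deriv q (w + s * e) = e * (deriv q (w + s * e) * e) := by ring
    rw [h4]
    exact h3
  refine ⟨e, he0, η, hη, StrictMonoOn.strictConvexOn_of_deriv (convex_Ioo _ _)
    (fun s hs => (hF s hs).continuousAt.continuousWithinAt) ?_⟩
  rw [interior_Ioo]
  refine StrictMonoOn.congr (f₁ := fun s : ℝ => (e * q (w + s * e)).re) ?_
    (fun s hs => (hF s hs).deriv.symm)
  refine strictMonoOn_of_deriv_pos (convex_Ioo _ _)
    (fun s hs => (hG s hs).continuousAt.continuousWithinAt) fun s hs => ?_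
  rw [interior_Ioo] at hs
  rw [(hG s hs).deriv]
  exact (hI s hs).2.2

/-- If `(φ'/φ)'` vanishes near a point, then `φ' = a φ` near that point, hence everywhere. -/
theorem isMultipleOfExponential_of_eventually {φ : ℂ → ℂ} (hφ : Differentiable ℂ φ) {w : ℂ}
    (hw : φ w ≠ 0) (hd : ∀ᶠ z in 𝓝 w, deriv (fun z => deriv φ z / φ z) z = 0) :
    IsMultipleOfExponential φ := by
  set q : ℂ → ℂ := fun z => deriv φ z / φ z with hq
  have hqa : AnalyticAt ℂ q w := (hφ.analyticAt w).deriv.div (hφ.analyticAt w) hw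
  have hev : ∀ᶠ z in 𝓝 w, φ z ≠ 0 ∧ DifferentiableAt ℂ q z ∧ deriv q z = 0 :=
    (hφ.continuous.continuousAt.eventually_ne hw).and
      ((hqa.eventually_analyticAt.mono fun z hz => hz.differentiableAt).and hd)
  obtain ⟨r, hr, hball⟩ := Metric.eventually_nhds_iff_ball.1 hev
  have hconst : ∀ z ∈ Metric.ball w r, q z = q w := fun z hz =>
    Metric.isOpen_ball.is_const_of_deriv_eq_zero (convex_ball w r).isPreconnected
      (fun z hz => (hball z hz).2.1.differentiableWithinAt) (fun z hz => (hball z hz).2.2) hz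
      (Metric.mem_ball_self hr)
  set a := q w
  have hφ' : Differentiable ℂ (deriv φ) := (hφ.contDiff (n := 2)).differentiable_deriv_two
  have hode : deriv φ = fun z => a * φ z := by
    refine AnalyticOnNhd.eq_of_eventuallyEq (z₀ := w) (fun z _ => hφ'.analyticAt z)
      (fun z _ => (hφ.const_mul a).analyticAt z) ?_
    filter_upwards [Metric.ball_mem_nhds w hr] with z hz
    have h1 := hconst z hz
    have h2 := (hball z hz).1
    rw [hq] at h1
    simp only at h1
    rw [← h1, div_mul_cancel₀ _ h2]
  have hder : ∀ z, HasDerivAt (fun z => φ z * Complex.exp (-(a * z))) 0 z := by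
    intro z
    have h1 : HasDerivAt (fun z => Complex.exp (-(a * z))) (Complex.exp (-(a * z)) * -(a * 1)) z :=
      (((hasDerivAt_id z).const_mul a).neg).cexp
    have h2 := (hφ z).hasDerivAt.mul h1
    have h3 : deriv φ z * Complex.exp (-(a * z)) + φ z * (Complex.exp (-(a * z)) * -(a * 1)) = 0 := by
      rw [hode]
      ring
    rw [h3] at h2
    exact h2
  refine ⟨a, φ 0, fun z => ?_⟩
  have h3 := is_const_of_deriv_eq_zero (fun z => (hder z).differentiableAt)
    (fun z => (hder z).deriv) z 0
  simp only [mul_zero, neg_zero, Complex.exp_zero, mul_one] at h3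
  rw [← h3, mul_assoc, ← Complex.exp_add]
  simp

/-! ### Radial convexity -/

/-- If `|φ| < 1` on an initial piece of a ray on which `|φ|` exceeds `1` somewhere, then the first
point where `|φ (t w)| ^ (1 / t)` is maximal satisfies a strict radial convexity inequality. -/
theorem exists_radial_lt {φ : ℂ → ℂ} (hφ : Continuous φ) {w : ℂ} (hw : 1 < ‖φ w‖) {δ : ℝ}
    (hδ : 0 < δ) (hlt : ∀ t : ℝ, 0 < t → t < δ → ‖φ (t * w)‖ < 1) :
    ∃ w₀ : ℂ, 1 < ‖φ w₀‖ ∧ ∀ s : ℝ, 0 < s → s < 1 → ‖φ (s * w₀)‖ < ‖φ w₀‖ ^ s := by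
  set ε := min (δ / 2) 1 with hε
  have hε0 : 0 < ε := lt_min (by positivity) one_pos
  have hεδ : ε < δ := (min_le_left _ _).trans_lt (by linarith)
  set g : ℝ → ℝ := fun t => ‖φ (t * w)‖ ^ t⁻¹ with hg
  have hgc : ContinuousOn g (Set.Icc ε 1) := by
    intro t ht
    have ht0 : 0 < t := hε0.trans_le ht.1
    refine ContinuousAt.continuousWithinAt (ContinuousAt.rpow ?_ (continuousAt_inv₀ ht0.ne')
      (Or.inr (inv_pos.2 ht0)))
    exact Continuous.continuousAt (by fun_prop)
  obtain ⟨t₁, ht₁, hmax⟩ := isCompact_Icc.exists_isMaxOn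
    (Set.nonempty_Icc.2 (min_le_right (δ / 2) 1)) hgc
  have hM : IsCompact (Set.Icc ε 1 ∩ g ⁻¹' {g t₁}) :=
    isCompact_Icc.of_isClosed_subset
      (hgc.preimage_isClosed_of_isClosed isClosed_Icc isClosed_singleton) Set.inter_subset_left
  obtain ⟨t₀, ⟨ht₀, hgt₀⟩, hleast⟩ := hM.exists_isLeast ⟨t₁, ht₁, rfl⟩
  have hgt₀' : g t₀ = g t₁ := hgt₀
  have ht₀0 : 0 < t₀ := hε0.trans_le ht₀.1
  have hG : 1 < g t₁ := by
    have h1 : g 1 = ‖φ w‖ := by simp [hg]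
    exact (h1 ▸ hw).trans_le (hmax (Set.right_mem_Icc.2 (min_le_right (δ / 2) 1)))
  have hpow : ‖φ (t₀ * w)‖ = g t₁ ^ t₀ := by
    rw [← hgt₀', hg, ← Real.rpow_mul (norm_nonneg _), inv_mul_cancel₀ ht₀0.ne', Real.rpow_one]
  refine ⟨t₀ * w, ?_, fun s hs hs1 => ?_⟩
  · rw [hpow]
    exact Real.one_lt_rpow hG ht₀0
  · rw [hpow, ← Real.rpow_mul (zero_le_one.trans hG.le), ← mul_assoc, ← Complex.ofReal_mul,
      mul_comm t₀ s]
    have hst : 0 < s * t₀ := mul_pos hs ht₀0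
    rcases lt_or_ge (s * t₀) ε with h | h
    · exact (hlt _ hst (h.trans hεδ)).trans (Real.one_lt_rpow hG hst)
    · have hst1 : s * t₀ < t₀ := by nlinarith
      have hmem : s * t₀ ∈ Set.Icc ε 1 := ⟨h, hst1.le.trans ht₀.2⟩
      have h2 : g (s * t₀) < g t₁ := by
        refine lt_of_le_of_ne (hmax hmem) fun heq => ?_
        exact absurd (hleast ⟨hmem, heq⟩) (not_le.2 hst1)
      have h3 : ‖φ ((s * t₀ : ℝ) * w)‖ = g (s * t₀) ^ (s * t₀) := by
        rw [hg]
        simp only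
        rw [← Real.rpow_mul (norm_nonneg _), inv_mul_cancel₀ hst.ne', Real.rpow_one]
      rw [h3]
      exact Real.rpow_lt_rpow (Real.rpow_nonneg (norm_nonneg _) _) h2 hst

/-! ### Admissible frequencies -/

/-- The frequencies used to build approximations: `t w` for a left parameter `t` and
`(w₁ + s e) / m` for a right parameter `s`. -/
noncomputable def frequency (m : ℕ) (w w₁ e : ℂ) : ℝ ⊕ ℝ → ℂ :=
  Sum.elim (fun t => t * w) fun s => (w₁ + s * e) / m

/-- Being a parameter of absolute value less than `η`, and positive if it is a left one. -/
def IsSmallParameter (η : ℝ) : ℝ ⊕ ℝ → Prop :=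
  Sum.elim (fun t => t ∈ Set.Ioo 0 η) fun s => s ∈ Set.Ioo (-η) η

/-- The radial inequality and `(φ'/φ)' ≠ 0` hold at a common point `w₁`; the number `ρ`, slightly
less than `|φ w₁| ^ (1 / m)`, leaves room for moving the frequencies. -/
theorem exists_good_center {φ : ℂ → ℂ} (hφ : Differentiable ℂ φ)
    (hexp : ¬ IsMultipleOfExponential φ) {w : ℂ} (hw : 1 < ‖φ w‖) {δ : ℝ}
    (hδ : 0 < δ) (hlt : ∀ t : ℝ, 0 < t → t < δ → ‖φ (t * w)‖ < 1) {m : ℕ} (hm : 1 ≤ m) :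
    ∃ (w₁ : ℂ) (ρ : ℝ), 1 < ρ ∧ ρ ^ m < ‖φ w₁‖ ∧
      (∀ r ∈ Finset.range m, 1 ≤ r → ‖φ (r * (w₁ / m))‖ < ρ ^ r) ∧
      deriv (fun z => deriv φ z / φ z) w₁ ≠ 0 := by
  obtain ⟨w₀, h1, h2⟩ := exists_radial_lt hφ.continuous hw hδ hlt
  have hc := hφ.continuous
  have hm0 : (0 : ℝ) < m := by exact_mod_cast hm
  have hev : ∀ᶠ z in 𝓝 w₀, 1 < ‖φ z‖ ∧
      ∀ r ∈ Finset.range m, 1 ≤ r → ‖φ (r * (z / m))‖ < ‖φ z‖ ^ ((r : ℝ) / m) := by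
    refine (hc.norm.continuousAt.eventually (lt_mem_nhds h1)).and ?_
    rw [Finset.eventually_all]
    intro r hr
    by_cases hr1 : 1 ≤ r
    · have h3 : ‖φ (r * (w₀ / m))‖ < ‖φ w₀‖ ^ ((r : ℝ) / m) := by
        have := h2 (r / m) (by positivity) (by
          rw [div_lt_one hm0]
          exact_mod_cast Finset.mem_range.1 hr)
        convert this using 3
        push_cast
        ring
      have hc1 : ContinuousAt (fun z => ‖φ (r * (z / m))‖) w₀ :=
        Continuous.continuousAt (by fun_prop)
      have hc2 : ContinuousAt (fun z => ‖φ z‖ ^ ((r : ℝ) / m)) w₀ :=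
        hc.norm.continuousAt.rpow_const (Or.inr (by positivity))
      filter_upwards [hc1.eventually_lt hc2 h3] with z hz _ using hz
    · exact Eventually.of_forall fun z h => absurd h hr1
  have hfreq : ∃ᶠ z in 𝓝 w₀, deriv (fun z => deriv φ z / φ z) z ≠ 0 := by
    intro h
    refine hexp (isMultipleOfExponential_of_eventually hφ (w := w₀) ?_ (by simpa using h))
    rintro h0
    rw [h0, norm_zero] at h1
    exact absurd h1 (by norm_num)
  obtain ⟨w₁, hw₁, h4, h5⟩ := (hfreq.and_eventually hev).exists
  set ρ₀ : ℝ := ‖φ w₁‖ ^ ((m : ℝ)⁻¹) with hρ₀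
  have hpow : ∀ r : ℕ, ‖φ w₁‖ ^ ((r : ℝ) / m) = ρ₀ ^ r := by
    intro r
    rw [hρ₀, ← Real.rpow_natCast, ← Real.rpow_mul (norm_nonneg _), div_eq_inv_mul]
  have hρ₀1 : 1 < ρ₀ := Real.one_lt_rpow h4 (by positivity)
  have hev2 : ∀ᶠ ρ in 𝓝[<] ρ₀, (1 < ρ ∧ ∀ r ∈ Finset.range m, 1 ≤ r →
      ‖φ (r * (w₁ / m))‖ < ρ ^ r) ∧ ρ < ρ₀ := by
    refine Eventually.and ?_ self_mem_nhdsWithin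
    refine nhdsWithin_le_nhds ((lt_mem_nhds hρ₀1).and ?_)
    rw [Finset.eventually_all]
    intro r hr
    by_cases hr1 : 1 ≤ r
    · filter_upwards [(continuous_pow r).continuousAt.eventually
        (lt_mem_nhds ((h5 r hr hr1).trans_eq (hpow r)))] with ρ hρ _ using hρ
    · exact Eventually.of_forall fun z h => absurd h hr1
  obtain ⟨ρ, ⟨hρ1, hρ⟩, hρ₀'⟩ := hev2.exists
  refine ⟨w₁, ρ, hρ1, ?_, hρ, hw₁⟩
  have : ‖φ w₁‖ = ρ₀ ^ m := by rw [← hpow, div_self hm0.ne', Real.rpow_one]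
  rw [this]
  exact pow_lt_pow_left₀ hρ₀' (by linarith) (by omega)

/-- The frequencies for a given degree `m`: every product of at most `m` exponentials decays under
`φ(D)`, after the normalization by the factors `θ`, unless it is the `m`-th power of a single
exponential with a right parameter; such a power is neutral. -/
theorem exists_frequencies {φ : ℂ → ℂ} (hφ : Differentiable ℂ φ)
    (hexp : ¬ IsMultipleOfExponential φ) {w : ℂ} (hw : 1 < ‖φ w‖) {δ : ℝ}
    (hδ : 0 < δ) (hlt : ∀ t : ℝ, 0 < t → t < δ → ‖φ (t * w)‖ < 1) {m : ℕ} (hm : 1 ≤ m) :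
    ∃ (w₁ e : ℂ) (η : ℝ) (θ : ℝ → ℂ), e ≠ 0 ∧ 0 < η ∧
      (∀ s ∈ Set.Ioo (-η) η, φ (w₁ + s * e) * θ s ^ m = 1 ∧ ‖θ s‖ < 1) ∧
      ∀ (n : ℕ) (p : Fin n → ℝ ⊕ ℝ), 1 ≤ n → n ≤ m → (∀ i, IsSmallParameter η (p i)) →
        (n = m → ∀ s, ∃ i, p i ≠ Sum.inr s) →
        ‖φ (∑ i, frequency m w w₁ e (p i))‖ * ∏ i, ‖Sum.elim (fun _ => 1) θ (p i)‖ < 1 := by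
  obtain ⟨w₁, ρ, hρ1, hρm, hρ, hd⟩ := exists_good_center hφ hexp hw hδ hlt hm
  have hm0 : (0 : ℝ) < m := by exact_mod_cast hm
  have hm1 : (1 : ℝ) ≤ m := by exact_mod_cast hm
  have hmC : (m : ℂ) ≠ 0 := by exact_mod_cast hm0.ne'
  have hρ0 : 0 < ρ := one_pos.trans hρ1
  have hw₁ : φ w₁ ≠ 0 := norm_pos_iff.1 ((pow_pos hρ0 m).trans hρm)
  obtain ⟨e, he, η₀, hη₀, hconv⟩ := exists_strictConvexOn_log_norm hφ hw₁ hd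
  have hc := hφ.continuous
  obtain ⟨ε, hε, hball⟩ : ∃ ε > 0, ∀ ζ : ℂ, ‖ζ‖ < ε → ∀ r ∈ Finset.range m, 1 ≤ r →
      ‖φ (r * (w₁ / m) + ζ)‖ < ρ ^ r := by
    have hev : ∀ᶠ ζ in 𝓝 (0 : ℂ), ∀ r ∈ Finset.range m, 1 ≤ r →
        ‖φ (r * (w₁ / m) + ζ)‖ < ρ ^ r := by
      rw [Finset.eventually_all]
      intro r hr
      by_cases hr1 : 1 ≤ r
      · have hc1 : ContinuousAt (fun ζ => ‖φ (r * (w₁ / m) + ζ)‖) 0 :=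
          Continuous.continuousAt (by fun_prop)
        filter_upwards [hc1.eventually (gt_mem_nhds (by simpa using hρ r hr hr1))] with z hz _ using hz
      · exact Eventually.of_forall fun z h => absurd h hr1
    simpa only [dist_zero_right] using Metric.eventually_nhds_iff.1 hev
  obtain ⟨η₁, hη₁, hball₁⟩ : ∃ η₁ > 0, ∀ s : ℝ, |s| < η₁ → ρ ^ m < ‖φ (w₁ + s * e)‖ := by
    have hc1 : ContinuousAt (fun s : ℝ => ‖φ (w₁ + s * e)‖) 0 :=
      Continuous.continuousAt (by fun_prop)
    have := Metric.eventually_nhds_iff.1 (hc1.eventually (lt_mem_nhds (by simpa using hρm)))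
    simpa only [dist_zero_right, Real.norm_eq_abs] using this
  set K := ‖w‖ + ‖e‖ + 1 with hK
  have hK0 : 0 < K := by positivity
  set η := min (min η₀ η₁) (min (ε / (2 * m * K)) (δ / m)) with hη
  have hη0 : 0 < η := by positivity
  have hηη₀ : η ≤ η₀ := (min_le_left _ _).trans (min_le_left _ _)
  have hηη₁ : η ≤ η₁ := (min_le_left _ _).trans (min_le_right _ _)
  have hηε : m * (η * K) < ε := by
    have : η ≤ ε / (2 * m * K) := (min_le_right _ _).trans (min_le_left _ _)
    rw [le_div_iff₀ (by positivity)] at this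
    nlinarith
  have hηδ : m * η ≤ δ := by
    have : η ≤ δ / m := (min_le_right _ _).trans (min_le_right _ _)
    rw [le_div_iff₀ hm0] at this
    linarith
  choose θ hθ using fun s : ℝ =>
    IsAlgClosed.exists_pow_nat_eq (φ (w₁ + s * e))⁻¹ (show 0 < m by omega)
  have hlarge : ∀ s ∈ Set.Ioo (-η) η, ρ ^ m < ‖φ (w₁ + s * e)‖ := fun s hs =>
    hball₁ s ((abs_lt.2 hs).trans_le hηη₁)
  have hne : ∀ s ∈ Set.Ioo (-η) η, φ (w₁ + s * e) ≠ 0 := fun s hs =>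
    norm_pos_iff.1 ((pow_pos hρ0 m).trans (hlarge s hs))
  have hθρ : ∀ s ∈ Set.Ioo (-η) η, ‖θ s‖ < ρ⁻¹ := by
    intro s hs
    refine lt_of_pow_lt_pow_left₀ m (by positivity) ?_
    rw [← norm_pow, hθ, norm_inv, inv_pow]
    exact inv_strictAnti₀ (pow_pos hρ0 m) (hlarge s hs)
  refine ⟨w₁, e, η, θ, he, hη0, fun s hs => ⟨?_, ?_⟩, ?_⟩
  · rw [hθ, mul_inv_cancel₀ (hne s hs)]
  · exact (hθρ s hs).trans (inv_lt_one_of_one_lt₀ hρ1)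
  intro n p hn hnm hp hnp
  by_cases hall : n = m ∧ ∀ i, (p i).isRight
  · -- all parameters are right ones, and strict convexity applies
    obtain ⟨rfl, hall⟩ := hall
    choose s hs using fun i => Sum.isRight_iff.1 (hall i)
    have hsI : ∀ i, s i ∈ Set.Ioo (-η) η := fun i => by
      have := hp i
      rw [hs i] at this
      exact this
    have hsI₀ : ∀ i, s i ∈ Set.Ioo (-η₀) η₀ := fun i =>
      ⟨by linarith [(hsI i).1], by linarith [(hsI i).2]⟩
    obtain ⟨i, hi⟩ := hnp rfl (s ⟨0, by omega⟩)
    have hlt := hconv.map_sum_lt (t := Finset.univ) (w := fun _ : Fin n => (n : ℝ)⁻¹) (p := s)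
      (fun _ _ => by positivity) (by simp [hm0.ne']) (fun i _ => hsI₀ i)
      ⟨i, Finset.mem_univ _, ⟨0, by omega⟩, Finset.mem_univ _, fun h => hi (by rw [hs i, h])⟩
    have hsum : ∑ i, frequency n w w₁ e (p i) = w₁ + ((∑ i, (n : ℝ)⁻¹ • s i : ℝ) : ℂ) * e := by
      have : ∀ i, frequency n w w₁ e (p i) = w₁ / n + (n : ℂ)⁻¹ * s i * e := by
        intro i
        rw [hs i]
        change (w₁ + s i * e) / n = _
        field_simp
      simp only [this, Finset.sum_add_distrib, Finset.sum_const, Finset.card_univ, Fintype.card_fin,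
        nsmul_eq_mul, smul_eq_mul]
      rw [mul_div_cancel₀ _ hmC, ← Finset.sum_mul]
      push_cast
      rfl
    have hprod : ∏ i, ‖Sum.elim (fun _ => 1) θ (p i)‖ = ∏ i, ‖θ (s i)‖ :=
      Finset.prod_congr rfl fun i _ => by rw [hs i]; rfl
    have hθ0 : ∀ i, 0 < ‖θ (s i)‖ := by
      intro i
      rw [norm_pos_iff]
      intro h0
      have := hθ (s i)
      rw [h0, zero_pow (by omega), eq_comm, inv_eq_zero] at this
      exact hne _ (hsI i) this
    have hlogθ : ∀ i, Real.log ‖θ (s i)‖ = -((n : ℝ)⁻¹ • Real.log ‖φ (w₁ + s i * e)‖) := by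
      intro i
      have := congrArg (fun z => Real.log ‖z‖) (hθ (s i))
      simp only [norm_pow, norm_inv, Real.log_pow, Real.log_inv] at this
      rw [smul_eq_mul]
      field_simp
      linarith
    rw [hsum, hprod]
    rcases eq_or_ne (φ (w₁ + ((∑ i, (n : ℝ)⁻¹ • s i : ℝ) : ℂ) * e)) 0 with h0 | h0
    · rw [h0, norm_zero, zero_mul]
      exact one_pos
    · have hpos : 0 < ∏ i, ‖θ (s i)‖ := Finset.prod_pos fun i _ => hθ0 i
      rw [← Real.log_neg_iff (mul_pos (norm_pos_iff.2 h0) hpos),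
        Real.log_mul (norm_ne_zero_iff.2 h0) hpos.ne', Real.log_prod (fun i _ => (hθ0 i).ne')]
      simp only [hlogθ, Finset.sum_neg_distrib]
      linarith
  · -- the sum of the frequencies is close to `r w₁ / m`, with `r < m` right parameters
    set r := (Finset.univ.filter fun i => (p i).isRight = true).card with hr
    have hrm : r < m := by
      have h1 : r ≤ n := by simpa using Finset.card_filter_le Finset.univ fun i => (p i).isRight = true
      rcases h1.lt_or_eq with h | h
      · omega
      · refine lt_of_le_of_ne (h1.trans hnm) fun h2 => hall ⟨by omega, fun i => ?_⟩
        have h3 := Finset.card_filter_eq_iff.1 (hr.symm.trans (h.trans (Finset.card_fin n).symm))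
        exact h3 i (Finset.mem_univ i)
    have hprod : ∏ i, ‖Sum.elim (fun _ => 1) θ (p i)‖ ≤ (ρ⁻¹) ^ r := by
      calc ∏ i, ‖Sum.elim (fun _ => 1) θ (p i)‖
          ≤ ∏ i, if (p i).isRight = true then ρ⁻¹ else 1 := by
            refine Finset.prod_le_prod (fun i _ => norm_nonneg _) fun i _ => ?_
            have := hp i
            rcases h : p i with t | s
            · simp
            · rw [h] at this
              simpa using (hθρ s this).le
        _ = (ρ⁻¹) ^ r := by
            rw [Finset.prod_ite, Finset.prod_const, Finset.prod_const_one, mul_one]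
    have hφr : ‖φ (∑ i, frequency m w w₁ e (p i))‖ < ρ ^ r := by
      rcases Nat.eq_zero_or_pos r with h0 | h0
      · -- all parameters are left ones, and the sum stays on the initial piece of the ray
        rw [h0, pow_zero]
        have hleft : ∀ i, ∃ t ∈ Set.Ioo 0 η, p i = Sum.inl t := by
          intro i
          have h1 := hp i
          have h2 := Finset.card_eq_zero.1 (hr.symm.trans h0)
          rcases h : p i with t | s
          · rw [h] at h1
            exact ⟨t, h1, rfl⟩
          · have : i ∈ Finset.univ.filter fun i => (p i).isRight = true := by simp [h]
            rw [h2] at this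
            simp at this
        choose t ht hpt using hleft
        have hsum : ∑ i, frequency m w w₁ e (p i) = ((∑ i, t i : ℝ) : ℂ) * w := by
          push_cast
          rw [Finset.sum_mul]
          exact Finset.sum_congr rfl fun i _ => by rw [hpt i]; rfl
        have hne' : (Finset.univ : Finset (Fin n)).Nonempty := ⟨⟨0, by omega⟩, Finset.mem_univ _⟩
        rw [hsum]
        refine hlt _ (Finset.sum_pos (fun i _ => (ht i).1) hne') ?_
        calc ∑ i, t i < ∑ _i : Fin n, η := Finset.sum_lt_sum_of_nonempty hne' fun i _ => (ht i).2
          _ = n * η := by simp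
          _ ≤ m * η := by gcongr
          _ ≤ δ := hηδ
      · have hbase : ∑ i, (if (p i).isRight = true then w₁ / m else 0) = r * (w₁ / m) := by
          rw [Finset.sum_ite, Finset.sum_const, Finset.sum_const_zero, add_zero, nsmul_eq_mul]
        have hsum : ∑ i, frequency m w w₁ e (p i) = r * (w₁ / m) +
            ∑ i, (frequency m w w₁ e (p i) - if (p i).isRight = true then w₁ / m else 0) := by
          rw [Finset.sum_sub_distrib, hbase]
          ring
        rw [hsum]
        refine hball _ ?_ r (Finset.mem_range.2 hrm) h0
        refine lt_of_le_of_lt ?_ hηε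
        calc _ ≤ ∑ _i : Fin n, η * K := by
              refine norm_sum_le_of_le _ fun i _ => ?_
              have h1 := hp i
              rcases h : p i with t | s
              · rw [h] at h1
                have h2 : |t| ≤ η := by
                  rw [abs_of_pos h1.1]
                  exact h1.2.le
                have h3 : ‖w‖ ≤ K := by
                  have := norm_nonneg e
                  linarith
                simp only [Sum.isRight_inl, Bool.false_eq_true, if_false, sub_zero]
                change ‖(t : ℂ) * w‖ ≤ _
                rw [norm_mul, Complex.norm_real, Real.norm_eq_abs]
                gcongr
              · rw [h] at h1
                have h2 : |s| ≤ η := (abs_lt.2 h1).le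
                have h3 : ‖e‖ ≤ K := by
                  have := norm_nonneg w
                  linarith
                simp only [Sum.isRight_inr, if_true]
                change ‖(w₁ + s * e) / m - w₁ / m‖ ≤ _
                rw [← sub_div, add_sub_cancel_left, norm_div, norm_mul, Complex.norm_real,
                  Real.norm_eq_abs, Complex.norm_natCast]
                calc |s| * ‖e‖ / m ≤ |s| * ‖e‖ := div_le_self (by positivity) hm1
                  _ ≤ η * K := by gcongr
          _ = n * (η * K) := by simp
          _ ≤ m * (η * K) := by gcongr
    calc _ ≤ ‖φ (∑ i, frequency m w w₁ e (p i))‖ * (ρ⁻¹) ^ r := by gcongr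
      _ < ρ ^ r * (ρ⁻¹) ^ r := by gcongr
      _ = 1 := by rw [← mul_pow, mul_inv_cancel₀ hρ0.ne', one_pow]

/-- An entire function of exponential type that is not a multiple of an exponential gives rise to a
hypercyclic algebra as soon as, along some ray, `|φ|` is initially less than `1` and later
exceeds `1`. -/
theorem supportsHypercyclicAlgebra_of_ray {φ : ℂ → ℂ} (hφ : Differentiable ℂ φ)
    (h : IsExponentialType φ) (hexp : ¬ IsMultipleOfExponential φ) {w : ℂ} (hw : 1 < ‖φ w‖) {δ : ℝ}
    (hδ : 0 < δ) (hlt : ∀ t : ℝ, 0 < t → t < δ → ‖φ (t * w)‖ < 1) :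
    SupportsHypercyclicAlgebra (convolutionOperator φ hφ h) := by
  classical
  refine supportsHypercyclicAlgebra_of_forall_isOpen _ fun m hm U V W hU hUne hV hVne hW hW0 => ?_
  obtain ⟨w₁, e, η, θ, he, hη, hθ, hdecay⟩ := exists_frequencies hφ hexp hw hδ hlt hm
  have hw0 : w ≠ 0 := by
    rintro rfl
    have := hlt (δ / 2) (by positivity) (by linarith)
    rw [mul_zero] at this
    exact lt_asymm hw this
  have hmC : (m : ℂ) ≠ 0 := by
    have : m ≠ 0 := by omega
    exact_mod_cast this
  obtain ⟨A, k, hA, hAU⟩ := exists_sum_expMul_mem hη 0 hw0 hU hUne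
  obtain ⟨B, l, hB, hBV⟩ := exists_sum_expMul_mem (show -η < η by linarith) w₁ he hV hVne
  choose b hb using fun s : ℝ => IsAlgClosed.exists_pow_nat_eq (l s) (show 0 < m by omega)
  let param : A ⊕ B → ℝ ⊕ ℝ := Sum.map (fun t => t.1) (fun s => s.1)
  have hparam : ∀ i, IsSmallParameter η (param i) := by
    rintro (t | s)
    · exact hA t.1 t.2
    · exact hB s.1 s.2
  let γ : A ⊕ B → ℂ := fun i => frequency m w w₁ e (param i)
  let Θ : A ⊕ B → ℂ := fun i => Sum.elim (fun _ => 1) θ (param i)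
  let a : A ⊕ B → ℂ := Sum.elim (fun t => k t) (fun s => b s)
  have hu : Tendsto (expSum γ Θ a) atTop (𝓝 (∑ t ∈ A, k t • expMul (0 + t * w))) := by
    have h1 := tendsto_expSum γ Θ a (Finset.univ.map Function.Embedding.inl) (by
      simp only [Finset.mem_map]
      rintro _ ⟨t, -, rfl⟩
      rfl) (by
      rintro (t | s) hi
      · simp at hi
      · exact (hθ s (hB s.1 s.2)).2)
    rw [Finset.sum_map] at h1
    rw [← Finset.sum_coe_sort]
    simp only [zero_add]
    exact h1
  have hlow : ∀ n ∈ Finset.Ico 1 m, Tendsto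
      (fun N => (convolutionOperator φ hφ h ^ N) (expSum γ Θ a N ^ n)) atTop (𝓝 0) := by
    intro n hn
    rw [Finset.mem_Ico] at hn
    simp only [pow_convolutionOperator_expSum_pow]
    have h1 := tendsto_expSum (fun p : Fin n → A ⊕ B => ∑ i, γ (p i))
      (fun p => φ (∑ i, γ (p i)) * ∏ i, Θ (p i)) (fun p => ∏ i, a (p i)) ∅ (by simp) (by
        intro p _
        rw [norm_mul, norm_prod]
        exact hdecay n (fun i => param (p i)) hn.1 hn.2.le (fun i => hparam _) (by omega))
    simpa using h1
  have hhigh : Tendsto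
      (fun N => (convolutionOperator φ hφ h ^ N) (expSum γ Θ a N ^ m)) atTop
      (𝓝 (∑ s ∈ B, l s • expMul (w₁ + s * e))) := by
    simp only [pow_convolutionOperator_expSum_pow]
    let ι : B ↪ (Fin m → A ⊕ B) := ⟨fun s _ => Sum.inr s, fun s s' hs => by
      simpa using congrFun hs ⟨0, by omega⟩⟩
    have hfreq : ∀ s : B, ∑ i : Fin m, γ (ι s i) = w₁ + s * e := by
      intro s
      change ∑ _i : Fin m, (w₁ + s * e) / m = _
      rw [Finset.sum_const, Finset.card_univ, Fintype.card_fin, nsmul_eq_mul, mul_div_cancel₀ _ hmC]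
    have h1 := tendsto_expSum (fun p : Fin m → A ⊕ B => ∑ i, γ (p i))
      (fun p => φ (∑ i, γ (p i)) * ∏ i, Θ (p i)) (fun p => ∏ i, a (p i))
      (Finset.univ.map ι) (by
        simp only [Finset.mem_map]
        rintro _ ⟨s, -, rfl⟩
        rw [hfreq]
        change φ (w₁ + s * e) * ∏ _i : Fin m, θ s = 1
        rw [Finset.prod_const, Finset.card_univ, Fintype.card_fin]
        exact (hθ s (hB s.1 s.2)).1) (by
        intro p hp
        rw [norm_mul, norm_prod]
        refine hdecay m (fun i => param (p i)) hm le_rfl (fun i => hparam _) fun _ s => ?_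
        by_contra! hs
        have hs' : ∀ i, ∃ s' : B, p i = Sum.inr s' ∧ s'.1 = s := by
          intro i
          have h2 := hs i
          rcases h3 : p i with t | s'
          · rw [h3] at h2
            simp [param] at h2
          · rw [h3] at h2
            exact ⟨s', rfl, by simpa [param] using h2⟩
        obtain ⟨s₀, -, hs₀⟩ := hs' ⟨0, by omega⟩
        refine hp (Finset.mem_map.2 ⟨s₀, Finset.mem_univ _, ?_⟩)
        funext i
        obtain ⟨s₁, h4, h5⟩ := hs' i
        rw [h4]
        exact congrArg Sum.inr (Subtype.ext (hs₀.trans h5.symm)))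
    rw [Finset.sum_map] at h1
    rw [← Finset.sum_coe_sort]
    convert h1 using 3 with s
    rw [hfreq]
    congr 1
    change l s = ∏ _i : Fin m, b s
    rw [Finset.prod_const, Finset.card_univ, Fintype.card_fin, hb]
  have hlow' : ∀ᶠ N in atTop, ∀ n ∈ Finset.Ico 1 m,
      (convolutionOperator φ hφ h ^ N) (expSum γ Θ a N ^ n) ∈ W := by
    rw [Finset.eventually_all]
    exact fun n hn => (hlow n hn).eventually (hW.mem_nhds hW0)
  obtain ⟨N, h1, h2, h3⟩ := ((hu.eventually (hU.mem_nhds hAU)).and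
    (hlow'.and (hhigh.eventually (hV.mem_nhds hBV)))).exists
  exact ⟨_, h1, N, fun n hn hnm => h2 n (Finset.mem_Ico.2 ⟨hn, hnm⟩), h3⟩

/-! ### Rays on which `|φ|` exceeds `1` -/

theorem exists_one_lt_norm {φ : ℂ → ℂ} (hφ : Differentiable ℂ φ)
    (hnc : ¬ ∃ c : ℂ, ∀ z : ℂ, φ z = c) : ∃ w, 1 < ‖φ w‖ := by
  by_contra! hb
  refine hnc ⟨φ 0, fun z => hφ.apply_eq_apply_of_bounded ?_ z 0⟩
  exact isBounded_iff_forall_norm_le.2 ⟨1, by rintro _ ⟨w, rfl⟩; exact hb w⟩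

/-- Phragmén–Lindelöf for functions of subexponential growth. -/
theorem norm_le_of_subexponential_of_imaginary_axis {f : ℂ → ℂ} (hf : Differentiable ℂ f)
    (hsub : HasSubexponentialGrowth f) {C : ℝ} (hC : ∀ x : ℝ, ‖f (x * Complex.I)‖ ≤ C)
    {z : ℂ} (hz : 0 ≤ z.re) : ‖f z‖ ≤ C := by
  have key : ∀ ε : ℝ, 0 < ε → ‖f z‖ * Real.exp (-(ε * z.re)) ≤ C := by
    intro ε hε
    have hnorm : ∀ z : ℂ, ‖f z * Complex.exp (-(ε * z))‖ = ‖f z‖ * Real.exp (-(ε * z.re)) := by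
      intro z
      rw [norm_mul, Complex.norm_exp, Complex.neg_re, Complex.re_ofReal_mul]
    -- the factor `exp (-ε z)` makes the function tend to `0` on the positive real axis
    obtain ⟨A, hA⟩ := hsub (ε / 2) (by positivity)
    have hA0 : 0 ≤ A := by simpa using (norm_nonneg _).trans (hA 0)
    rw [← hnorm]
    refine PhragmenLindelof.right_half_plane_of_tendsto_zero_on_real
      (f := fun z => f z * Complex.exp (-(ε * z))) (Differentiable.diffContOnCl (by fun_prop))
      ⟨1, by norm_num, ε / 2, ?_⟩ ?_ ?_ hz
    · refine Asymptotics.IsBigO.of_bound A ?_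
      refine eventually_inf_principal.2 (Eventually.of_forall fun z hz => ?_)
      rw [hnorm, Real.rpow_one, Real.norm_eq_abs, abs_of_pos (Real.exp_pos _)]
      have : Real.exp (-(ε * z.re)) ≤ 1 :=
        Real.exp_le_one_iff.2 (neg_nonpos.2 (mul_nonneg hε.le (le_of_lt hz)))
      calc _ ≤ ‖f z‖ * 1 := by gcongr
        _ ≤ _ := by rw [mul_one]; exact hA z
    · have hlim : Tendsto (fun x : ℝ => A * Real.exp (-(ε / 2 * x))) atTop (𝓝 0) := by
        have h1 : Tendsto (fun x : ℝ => ε / 2 * x) atTop atTop :=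
          tendsto_id.const_mul_atTop (by positivity)
        simpa using (Real.tendsto_exp_neg_atTop_nhds_zero.comp h1).const_mul A
      refine squeeze_zero_norm' ?_ hlim
      filter_upwards [eventually_ge_atTop 0] with x hx
      rw [hnorm, Complex.ofReal_re]
      have h1 := hA x
      rw [Complex.norm_real, Real.norm_eq_abs, abs_of_nonneg hx] at h1
      calc _ ≤ A * Real.exp (ε / 2 * x) * Real.exp (-(ε * x)) := by gcongr
        _ = A * Real.exp (-(ε / 2 * x)) := by
          rw [mul_assoc, ← Real.exp_add]
          ring_nf
    · intro x
      rw [hnorm]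
      simpa using hC x
  have hlim : Tendsto (fun ε : ℝ => ‖f z‖ * Real.exp (-(ε * z.re))) (𝓝[>] 0) (𝓝 ‖f z‖) := by
    have : Continuous fun ε : ℝ => ‖f z‖ * Real.exp (-(ε * z.re)) := by fun_prop
    simpa using (this.tendsto 0).mono_left nhdsWithin_le_nhds
  exact le_of_tendsto hlim (eventually_mem_nhdsWithin.mono key)

theorem HasSubexponentialGrowth.comp_mul {f : ℂ → ℂ} (hsub : HasSubexponentialGrowth f) (u : ℂ) :
    HasSubexponentialGrowth fun z => f (u * z) := by
  intro ε hε
  obtain ⟨C, hC⟩ := hsub (ε / (‖u‖ + 1)) (by positivity)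
  refine ⟨C, fun z => (hC _).trans ?_⟩
  have hC0 : 0 ≤ C := by simpa using (norm_nonneg _).trans (hC 0)
  refine mul_le_mul_of_nonneg_left (Real.exp_le_exp.2 ?_) hC0
  rw [norm_mul, div_mul_eq_mul_div, div_le_iff₀ (by positivity)]
  nlinarith [norm_nonneg z, norm_nonneg u, mul_nonneg hε.le (norm_nonneg z)]

/-- A nonconstant entire function of subexponential growth is not bounded by `1` on the open left
half plane: otherwise it would be bounded by `1` on the right half plane, too. -/
theorem exists_one_lt_norm_of_re_neg {f : ℂ → ℂ} (hf : Differentiable ℂ f)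
    (hsub : HasSubexponentialGrowth f) (hnc : ¬ ∃ c : ℂ, ∀ z : ℂ, f z = c) :
    ∃ z : ℂ, z.re < 0 ∧ 1 < ‖f z‖ := by
  by_contra! hb
  have hle : ∀ z : ℂ, z.re ≤ 0 → ‖f z‖ ≤ 1 := by
    intro z hz
    have hlim : Tendsto (fun t : ℝ => ‖f (z - t)‖) (𝓝[>] 0) (𝓝 ‖f z‖) := by
      have h1 := hf.continuous
      have : Continuous fun t : ℝ => ‖f (z - t)‖ := by fun_prop
      simpa using (this.tendsto 0).mono_left nhdsWithin_le_nhds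
    refine le_of_tendsto hlim ?_
    filter_upwards [self_mem_nhdsWithin] with t ht
    refine hb _ ?_
    have : 0 < t := ht
    simp only [Complex.sub_re, Complex.ofReal_re]
    linarith
  obtain ⟨w, hw⟩ := exists_one_lt_norm hf hnc
  refine absurd hw (not_lt.2 ?_)
  rcases le_total w.re 0 with h | h
  · exact hle w h
  · exact norm_le_of_subexponential_of_imaginary_axis hf hsub (fun x => hle _ (by simp)) h

/-- If `z ↦ f (z ^ 2)` has subexponential growth, then a nonconstant `f` is not bounded by `1` on the
negative real axis, as squaring maps the imaginary axis to it. -/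
theorem exists_one_lt_norm_of_neg {f : ℂ → ℂ} (hf : Differentiable ℂ f)
    (hsub : HasSubexponentialGrowth fun z => f (z ^ 2)) (hnc : ¬ ∃ c : ℂ, ∀ z : ℂ, f z = c) :
    ∃ t : ℝ, 0 < t ∧ 1 < ‖f (-t)‖ := by
  by_contra! hb
  have hb0 : ‖f 0‖ ≤ 1 := by
    have hlim : Tendsto (fun t : ℝ => ‖f (-t)‖) (𝓝[>] 0) (𝓝 ‖f 0‖) := by
      have h1 := hf.continuous
      have : Continuous fun t : ℝ => ‖f (-t)‖ := by fun_prop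
      simpa using (this.tendsto 0).mono_left nhdsWithin_le_nhds
    exact le_of_tendsto hlim (eventually_mem_nhdsWithin.mono hb)
  obtain ⟨w, hw⟩ := exists_one_lt_norm hf hnc
  have hax : ∀ x : ℝ, ‖f ((x * Complex.I) ^ 2)‖ ≤ 1 := by
    intro x
    rw [mul_pow, Complex.I_sq, mul_neg_one]
    rcases eq_or_ne x 0 with rfl | hx
    · simpa using hb0
    · have := hb (x ^ 2) (by positivity)
      push_cast at this
      exact this
  obtain ⟨z, hz⟩ := IsAlgClosed.exists_pow_nat_eq w two_pos
  have hcase : ∀ z : ℂ, 0 ≤ z.re → ‖f (z ^ 2)‖ ≤ 1 := fun z hz =>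
    norm_le_of_subexponential_of_imaginary_axis (f := fun z => f (z ^ 2)) (by fun_prop) hsub hax hz
  refine absurd hw (not_lt.2 ?_)
  rcases le_total 0 z.re with h | h
  · exact hz ▸ hcase z h
  · have := hcase (-z) (by simpa using h)
    rwa [neg_sq, hz] at this

/-- If `φ z = φ 0 (1 + z ^ p g z)` with `|φ 0| = 1`, then `|φ| < 1` on an initial piece of each ray
in a direction `u` with `Re (u ^ p g 0) < 0`. -/
theorem exists_forall_norm_lt_one {φ g : ℂ → ℂ} (h0 : ‖φ 0‖ = 1) {p : ℕ} (hp : 1 ≤ p)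
    (hg : ContinuousAt g 0) (hφg : ∀ᶠ z in 𝓝 0, φ z = φ 0 * (1 + z ^ p * g z)) {u : ℂ}
    (hu : (u ^ p * g 0).re < 0) :
    ∃ δ : ℝ, 0 < δ ∧ ∀ t : ℝ, 0 < t → t < δ → ‖φ (t * u)‖ < 1 := by
  have hline : Tendsto (fun t : ℝ => (t : ℂ) * u) (𝓝[>] 0) (𝓝 0) := by
    have : Continuous fun t : ℝ => (t : ℂ) * u := by fun_prop
    simpa using (this.tendsto 0).mono_left nhdsWithin_le_nhds
  have hlim : Tendsto (fun t : ℝ => 2 * (u ^ p * g (t * u)).re + t ^ p * ‖u ^ p * g (t * u)‖ ^ 2)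
      (𝓝[>] 0) (𝓝 (2 * (u ^ p * g 0).re + 0 ^ p * ‖u ^ p * g 0‖ ^ 2)) := by
    have h1 : Tendsto (fun t : ℝ => u ^ p * g (t * u)) (𝓝[>] 0) (𝓝 (u ^ p * g 0)) :=
      (hg.tendsto.comp hline).const_mul _
    have h2 : Tendsto (fun t : ℝ => t ^ p) (𝓝[>] 0) (𝓝 (0 ^ p)) :=
      ((continuous_pow p).tendsto 0).mono_left nhdsWithin_le_nhds
    exact (((Complex.continuous_re.tendsto _).comp h1).const_mul 2).add (h2.mul (h1.norm.pow 2))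
  rw [zero_pow (by omega), zero_mul, add_zero] at hlim
  have hev := (hlim.eventually (gt_mem_nhds (show _ < (0 : ℝ) by linarith))).and
    (hline.eventually hφg)
  obtain ⟨δ, hδ, hI⟩ := mem_nhdsGT_iff_exists_Ioo_subset.1 hev
  refine ⟨δ, hδ, fun t ht htδ => ?_⟩
  obtain ⟨h1, h2⟩ := hI ⟨ht, htδ⟩
  have h3 : (t * u) ^ p * g (t * u) = ((t ^ p : ℝ) : ℂ) * (u ^ p * g (t * u)) := by
    push_cast
    ring
  rw [h2, norm_mul, h0, one_mul, h3]
  set c := u ^ p * g (t * u)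
  have htp : 0 < t ^ p := pow_pos ht p
  have h4 : ‖1 + ((t ^ p : ℝ) : ℂ) * c‖ ^ 2 = 1 + t ^ p * (2 * c.re + t ^ p * ‖c‖ ^ 2) := by
    rw [← Complex.normSq_eq_norm_sq, ← Complex.normSq_eq_norm_sq, Complex.normSq_apply,
      Complex.normSq_apply]
    simp only [Complex.add_re, Complex.one_re, Complex.re_ofReal_mul, Complex.add_im,
      Complex.one_im, Complex.im_ofReal_mul]
    ring
  refine lt_of_pow_lt_pow_left₀ 2 zero_le_one ?_
  rw [h4, one_pow]
  nlinarith

/-- The local normal form of a nonconstant entire function at a point where it does not vanish. -/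
theorem exists_local_form {φ : ℂ → ℂ} (hφ : Differentiable ℂ φ)
    (hnc : ¬ ∃ c : ℂ, ∀ z : ℂ, φ z = c) (h0 : φ 0 ≠ 0) :
    ∃ (p : ℕ) (g : ℂ → ℂ), 1 ≤ p ∧ AnalyticAt ℂ g 0 ∧ g 0 ≠ 0 ∧
      ∀ᶠ z in 𝓝 0, φ z = φ 0 * (1 + z ^ p * g z) := by
  have hψ : AnalyticAt ℂ (fun z => φ z - φ 0) 0 := (hφ.sub_const _).analyticAt 0
  have hne : ¬ ∀ᶠ z in 𝓝 (0 : ℂ), φ z - φ 0 = 0 := by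
    intro h
    refine hnc ⟨φ 0, fun z => ?_⟩
    have := AnalyticOnNhd.eq_of_eventuallyEq (f := φ) (g := fun _ => φ 0) (z₀ := 0)
      (fun z _ => hφ.analyticAt z) (fun z _ => analyticAt_const)
      (h.mono fun z hz => sub_eq_zero.1 hz)
    exact congrFun this z
  obtain ⟨p, g, hg, hg0, heq⟩ := hψ.exists_eventuallyEq_pow_smul_nonzero_iff.2 hne
  refine ⟨p, fun z => g z / φ 0, ?_, hg.div analyticAt_const h0, div_ne_zero hg0 h0, ?_⟩
  · by_contra! hp
    have h1 := heq.self_of_nhds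
    have hp0 : p = 0 := by omega
    rw [hp0, sub_self, pow_zero, one_smul] at h1
    exact hg0 h1.symm
  · filter_upwards [heq] with z hz
    rw [sub_zero, smul_eq_mul] at hz
    field_simp
    linear_combination hz

/-- An entire function of order less than `1 / 2` is `O(exp (|z| ^ c))` with `c < 1 / 2`. -/
theorem exists_rpow_bound_of_entireOrder_lt {φ : ℂ → ℂ} (hφ : Differentiable ℂ φ)
    (h : entireOrder φ < ((1 / 2 : ℝ) : EReal)) :
    ∃ c : ℝ, 0 < c ∧ c < 1 / 2 ∧ ∃ A : ℝ, ∀ z : ℂ, ‖φ z‖ ≤ A * Real.exp (‖z‖ ^ c) := by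
  obtain ⟨c, hc1, hc2⟩ := EReal.lt_iff_exists_real_btwn.1 h
  have hc2' : c < 1 / 2 := by exact_mod_cast hc2
  have hev := eventually_lt_of_limsup_lt hc1
  obtain ⟨r₀, hr₀⟩ := eventually_atTop.1 (hev.and (eventually_gt_atTop 1))
  set d := max c (1 / 4) with hd
  have hle : ∀ z : ℂ, ‖φ z‖ ≤ maxModulus φ ‖z‖ := by
    intro z
    refine le_csSup ?_ ⟨z, by simp, rfl⟩
    exact ((isCompact_sphere 0 ‖z‖).image hφ.continuous.norm).bddAbove
  obtain ⟨C, hC⟩ := exists_bound_closedBall hφ.continuous 0 r₀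
  refine ⟨d, by positivity, max_lt hc2' (by norm_num), max C 1, fun z => ?_⟩
  have hexp : 1 ≤ Real.exp (‖z‖ ^ d) := Real.one_le_exp (by positivity)
  rcases le_total ‖z‖ r₀ with hz | hz
  · calc ‖φ z‖ ≤ C := hC z (by simpa using hz)
      _ ≤ max C 1 * 1 := by rw [mul_one]; exact le_max_left _ _
      _ ≤ _ := by gcongr
  · obtain ⟨h1, h2⟩ := hr₀ _ hz
    have h1' : Real.log (Real.log (maxModulus φ ‖z‖)) / Real.log ‖z‖ < c := by exact_mod_cast h1
    have hM : maxModulus φ ‖z‖ ≤ Real.exp (‖z‖ ^ d) := by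
      rcases le_or_gt (maxModulus φ ‖z‖) 1 with hM | hM
      · -- here the iterated logarithm carries no information, but `M(r) ≤ 1` is small enough
        exact hM.trans hexp
      · have hl : 0 < Real.log (maxModulus φ ‖z‖) := Real.log_pos hM
        rw [← Real.log_le_iff_le_exp (by linarith)]
        rw [div_lt_iff₀ (Real.log_pos h2)] at h1'
        calc Real.log (maxModulus φ ‖z‖) ≤ ‖z‖ ^ c := by
              rw [← Real.log_le_log_iff hl (by positivity), Real.log_rpow (by linarith)]
              exact h1'.le
          _ ≤ ‖z‖ ^ d := Real.rpow_le_rpow_of_exponent_le h2.le (le_max_left _ _)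
    calc ‖φ z‖ ≤ 1 * Real.exp (‖z‖ ^ d) := by rw [one_mul]; exact (hle z).trans hM
      _ ≤ _ := by
        gcongr
        exact le_max_right _ _

theorem hasSubexponentialGrowth_comp_sq {φ : ℂ → ℂ} (hφ : Differentiable ℂ φ)
    (h : entireOrder φ < ((1 / 2 : ℝ) : EReal)) :
    HasSubexponentialGrowth fun z => φ (z ^ 2) := by
  obtain ⟨c, hc0, hc, A, hA⟩ := exists_rpow_bound_of_entireOrder_lt hφ h
  have hA0 : 0 ≤ A := by
    have := (norm_nonneg _).trans (hA 0)
    exact nonneg_of_mul_nonneg_left this (Real.exp_pos _)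
  intro ε hε
  -- `r ^ (2 c) ≤ ε r` for large `r`, since `2 c < 1`
  have hlim : Tendsto (fun r : ℝ => r ^ (-(1 - 2 * c))) atTop (𝓝 0) :=
    tendsto_rpow_neg_atTop (by linarith)
  obtain ⟨r₀, hr₀⟩ := eventually_atTop.1
    ((hlim.eventually (gt_mem_nhds hε)).and (eventually_gt_atTop 0))
  have hr₀0 : 0 < r₀ := (hr₀ r₀ le_rfl).2
  refine ⟨A * Real.exp (r₀ ^ (2 * c)), fun z => (hA _).trans ?_⟩
  rw [mul_assoc, ← Real.exp_add]
  gcongr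
  rw [norm_pow, ← Real.rpow_natCast, ← Real.rpow_mul (norm_nonneg z)]
  push_cast
  have hr₀pos : 0 ≤ r₀ ^ (2 * c) := by positivity
  have hεz : 0 ≤ ε * ‖z‖ := by positivity
  rcases le_total ‖z‖ r₀ with hz | hz
  · have : ‖z‖ ^ (2 * c) ≤ r₀ ^ (2 * c) := by gcongr
    linarith
  · obtain ⟨h1, h2⟩ := hr₀ _ hz
    have h3 : ‖z‖ ^ (2 * c) = ‖z‖ ^ (-(1 - 2 * c)) * ‖z‖ := by
      rw [← Real.rpow_add_one h2.ne']
      ring_nf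
    have : ‖z‖ ^ (2 * c) ≤ ε * ‖z‖ := by
      rw [h3]
      gcongr
    linarith

/-! ### Multiples of exponentials -/

theorem not_isMultipleOfExponential_of_subexponential {φ : ℂ → ℂ}
    (hnc : ¬ ∃ c : ℂ, ∀ z : ℂ, φ z = c) (hsub : HasSubexponentialGrowth φ) :
    ¬ IsMultipleOfExponential φ := by
  rintro ⟨a, c, h⟩
  have ha : a ≠ 0 := by
    rintro rfl
    exact hnc ⟨c, fun z => by simp [h z]⟩
  have hc : c ≠ 0 := by
    rintro rfl
    exact hnc ⟨0, fun z => by simp [h z]⟩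
  have ha' : 0 < ‖a‖ := norm_pos_iff.2 ha
  obtain ⟨C, hC⟩ := hsub (‖a‖ / 2) (by positivity)
  have hbound : ∀ t : ℝ, 0 ≤ t → ‖c‖ * Real.exp (t / 2) ≤ C := by
    intro t ht
    have h1 := hC (t / a)
    rw [h, mul_div_cancel₀ _ ha, norm_mul, Complex.norm_exp, Complex.ofReal_re, norm_div,
      Complex.norm_real, Real.norm_eq_abs, abs_of_nonneg ht] at h1
    have h2 : ‖a‖ / 2 * (t / ‖a‖) = t / 2 := by field_simp
    have h3 : Real.exp t = Real.exp (t / 2) * Real.exp (t / 2) := by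
      rw [← Real.exp_add]
      ring_nf
    rw [h2, h3, ← mul_assoc] at h1
    exact le_of_mul_le_mul_right h1 (Real.exp_pos _)
  have hc' : 0 < ‖c‖ := norm_pos_iff.2 hc
  have h4 := hbound (2 * (|C| / ‖c‖)) (by positivity)
  have h5 := Real.add_one_le_exp (2 * (|C| / ‖c‖) / 2)
  have h6 : 2 * (|C| / ‖c‖) / 2 = |C| / ‖c‖ := by ring
  rw [h6] at h4 h5
  have h7 : |C| + ‖c‖ ≤ ‖c‖ * Real.exp (|C| / ‖c‖) := by
    calc |C| + ‖c‖ = ‖c‖ * (|C| / ‖c‖ + 1) := by field_simp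
      _ ≤ _ := by gcongr
  linarith [le_abs_self C]

/-- By Taylor's formula `φ(D) f = c f (· + a)` if `φ z = c exp (a z)`. -/
theorem convolutionOperator_pow_apply_of_exp {φ : ℂ → ℂ} (hφ : Differentiable ℂ φ)
    (h : IsExponentialType φ) {a c : ℂ} (hac : ∀ z, φ z = c * Complex.exp (a * z))
    (f : EntireFunctions) (N : ℕ) (z : ℂ) :
    ((convolutionOperator φ hφ h ^ N) f).1 z = c ^ N * f.1 (z + N * a) := by
  have hderiv : ∀ n : ℕ, iteratedDeriv n φ 0 = c * a ^ n := by
    intro n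
    have h1 : φ = fun z => c * Complex.exp (a * z) := funext hac
    rw [h1, iteratedDeriv_const_mul_field, iteratedDeriv_cexp_const_mul]
    simp
  have hone : ∀ (f : EntireFunctions) (z : ℂ),
      (convolutionOperator φ hφ h f).1 z = c * f.1 (z + a) := by
    intro f z
    have h1 := hasSum_convolutionOperator φ hφ h f z
    have h2 := (Complex.hasSum_taylorSeries_of_entire
      (show Differentiable ℂ f.1 from f.2) z (z + a)).mul_left c
    have h3 : ∀ n : ℕ, iteratedDeriv n φ 0 / (n.factorial : ℂ) * iteratedDeriv n f.1 z
        = c * ((n.factorial : ℂ)⁻¹ • (z + a - z) ^ n • iteratedDeriv n f.1 z) := by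
      intro n
      rw [hderiv, add_sub_cancel_left]
      simp only [smul_eq_mul]
      ring
    simp only [h3] at h1
    exact h1.unique h2
  induction N generalizing z with
  | zero => simp
  | succ N ih =>
    rw [pow_succ', mul_apply_eq_comp, hone, ih, ← mul_assoc, pow_succ']
    congr 2
    push_cast
    ring

/-- The square of an entire function is not close to `z` on the unit disc: the derivative at `0` of
`h ^ 2` is `2 h(0) h'(0)`, where `h(0)` is small and `h'(0)` is bounded by Cauchy's estimate. -/
theorem exists_le_norm_sub_sq {f : ℂ → ℂ} (hf : Differentiable ℂ f) :
    ∃ z : ℂ, ‖z‖ ≤ 1 ∧ 1 / 16 ≤ ‖z - f z ^ 2‖ := by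
  by_contra! hb
  have h0 : ‖f 0‖ ≤ 1 / 4 := by
    have h1 := hb 0 (by simp)
    rw [zero_sub, norm_neg, norm_pow] at h1
    nlinarith [norm_nonneg (f 0)]
  have hbound : ∀ z ∈ Metric.sphere (0 : ℂ) 1, ‖f z‖ ≤ 5 / 4 := by
    intro z hz
    rw [mem_sphere_zero_iff_norm] at hz
    have h1 := hb z hz.le
    have h2 : ‖f z ^ 2‖ ≤ ‖z‖ + ‖z - f z ^ 2‖ := by
      have := norm_sub_le z (z - f z ^ 2)
      rwa [sub_sub_cancel] at this
    rw [norm_pow, hz] at h2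
    nlinarith [norm_nonneg (f z)]
  have hd := Complex.norm_deriv_le_of_forall_mem_sphere_norm_le one_pos hf.diffContOnCl hbound
  have hg : Differentiable ℂ fun z => z - f z ^ 2 := by fun_prop
  have hd2 := Complex.norm_deriv_le_of_forall_mem_sphere_norm_le one_pos
    (hg.diffContOnCl (s := Metric.ball 0 1))
    (fun z hz => (hb z (mem_sphere_zero_iff_norm.1 hz).le).le)
  have h3 : deriv (fun z => z - f z ^ 2) 0 = 1 - 2 * f 0 * deriv f 0 := by
    have h4 := (hasDerivAt_id (0 : ℂ)).sub ((hf 0).hasDerivAt.pow 2)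
    have h5 := h4.deriv
    simp only [Nat.cast_ofNat, Nat.add_one_sub_one, pow_one] at h5
    exact h5
  rw [h3] at hd2
  have h6 : (1 : ℝ) ≤ ‖1 - 2 * f 0 * deriv f 0‖ + ‖2 * f 0 * deriv f 0‖ := by
    have := norm_add_le (1 - 2 * f 0 * deriv f 0) (2 * f 0 * deriv f 0)
    simpa using this
  rw [norm_mul, norm_mul, Complex.norm_ofNat] at h6
  have h7 : ‖f 0‖ * ‖deriv f 0‖ ≤ 1 / 4 * (5 / 4 / 1) := by gcongr
  linarith

/-- If `φ = c exp (a z)`, then `φ(D)` is a multiple of a translation, so that the orbit of a square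
consists of squares and cannot be dense. -/
theorem not_supportsHypercyclicAlgebra_of_exp {φ : ℂ → ℂ} (hφ : Differentiable ℂ φ)
    (h : IsExponentialType φ) (hexp : IsMultipleOfExponential φ) :
    ¬ SupportsHypercyclicAlgebra (convolutionOperator φ hφ h) := by
  obtain ⟨a, c, hac⟩ := hexp
  rintro ⟨A, hA, hhyp⟩
  obtain ⟨f, hfA, hf0⟩ : ∃ f ∈ A, f ≠ 0 := by
    by_contra! h0
    refine hA (eq_bot_iff.2 fun f hf => ?_)
    rw [NonUnitalAlgebra.mem_bot]
    exact h0 f hf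
  have hsq0 : f * f ≠ 0 := by
    intro h0
    refine hf0 (EntireFunctions.ext_apply fun z => ?_)
    have h1 : f.1 z * f.1 z = 0 := congrArg (fun g : EntireFunctions => g.1 z) h0
    exact mul_self_eq_zero.1 h1
  have hcl := mem_closure_iff_frequently.1 (hhyp (f * f) (A.mul_mem hfA hfA) hsq0 coordinate)
  obtain ⟨_, ⟨N, rfl⟩, hN⟩ := (hcl.and_eventually
    (EntireFunctions.tendsto_iff.1 tendsto_id 1 (1 / 16) (by norm_num))).exists
  obtain ⟨k, hk⟩ := IsAlgClosed.exists_pow_nat_eq (c ^ N) two_pos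
  have hf : Differentiable ℂ f.1 := f.2
  obtain ⟨z, hz, hle⟩ := exists_le_norm_sub_sq (f := fun z => k * f.1 (z + N * a)) (by fun_prop)
  refine absurd (hN z hz) (not_lt.2 ?_)
  have h1 : ((convolutionOperator φ hφ h ^ N) (f * f)).1 z = (k * f.1 (z + N * a)) ^ 2 := by
    rw [convolutionOperator_pow_apply_of_exp hφ h hac, mul_pow, hk, sq (f.1 _)]
    rfl
  simp only [id]
  rw [h1]
  exact hle

/-! ### Conclusion -/

theorem theorem1p1 (φ : ℂ → ℂ) (hφ : Differentiable ℂ φ) (hexp : IsExponentialType φ)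
    (hnc : ¬ ∃ c : ℂ, ∀ z : ℂ, φ z = c) :
    (‖φ 0‖ < 1 →
      (SupportsHypercyclicAlgebra (convolutionOperator φ hφ hexp) ↔
        ¬ IsMultipleOfExponential φ)) ∧
    (‖φ 0‖ = 1 → HasSubexponentialGrowth φ →
      (deriv φ 0 ≠ 0 ∨ entireOrder φ < ((1 / 2 : ℝ) : EReal)) →
      SupportsHypercyclicAlgebra (convolutionOperator φ hφ hexp)) := by
  refine ⟨fun h0 => ⟨fun h hm => not_supportsHypercyclicAlgebra_of_exp hφ hexp hm h, fun hm => ?_⟩,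
    fun h0 hsub hcase => ?_⟩
  · -- `|φ| < 1` near `0`, so any ray reaching a point with `|φ| > 1` will do
    obtain ⟨w, hw⟩ := exists_one_lt_norm hφ hnc
    have hc := hφ.continuous
    have hlim : Tendsto (fun t : ℝ => ‖φ (t * w)‖) (𝓝 0) (𝓝 ‖φ 0‖) := by
      have : Continuous fun t : ℝ => ‖φ (t * w)‖ := by fun_prop
      simpa using this.tendsto 0
    obtain ⟨δ, hδ, hball⟩ := Metric.eventually_nhds_iff.1 (hlim.eventually (gt_mem_nhds h0))
    refine supportsHypercyclicAlgebra_of_ray hφ hexp hm hw hδ fun t ht htδ => hball ?_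
    rwa [dist_zero_right, Real.norm_eq_abs, abs_of_pos ht]
  · have hm := not_isMultipleOfExponential_of_subexponential hnc hsub
    have hφ0 : φ 0 ≠ 0 := by
      intro h
      simp [h] at h0
    rcases hcase with hd | hord
    · set b := deriv φ 0 / φ 0 with hb
      have hb0 : b ≠ 0 := div_ne_zero hd hφ0
      obtain ⟨z, hz, hw⟩ := exists_one_lt_norm_of_re_neg (f := fun z => φ (b⁻¹ * z)) (by fun_prop)
        (hsub.comp_mul b⁻¹) (by
          rintro ⟨c, hc⟩
          exact hnc ⟨c, fun z => by simpa [hb0] using hc (b * z)⟩)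
      obtain ⟨δ, hδ, hlt⟩ := exists_forall_norm_lt_one (φ := φ) (g := fun z => dslope φ 0 z / φ 0)
        (u := b⁻¹ * z) h0 le_rfl
        ((continuousAt_dslope_same.2 (hφ 0)).div_const _) (Eventually.of_forall fun z => by
          have h1 := sub_smul_dslope φ 0 z
          rw [sub_zero, smul_eq_mul] at h1
          field_simp
          linear_combination -h1) (by
          simp only [dslope_same, pow_one, ← hb]
          rwa [mul_comm, mul_inv_cancel_left₀ hb0])
      exact supportsHypercyclicAlgebra_of_ray hφ hexp hm hw hδ hlt
    · obtain ⟨p, g, hp, hg, hg0, heq⟩ := exists_local_form hφ hnc hφ0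
      -- the direction of steepest descent of `|φ|` at `0`
      obtain ⟨v, hv⟩ := IsAlgClosed.exists_pow_nat_eq (-(g 0)⁻¹) (show 0 < p by omega)
      have hv0 : v ≠ 0 := by
        rintro rfl
        rw [zero_pow (by omega), eq_comm, neg_eq_zero, inv_eq_zero] at hv
        exact hg0 hv
      obtain ⟨k, hk⟩ := IsAlgClosed.exists_pow_nat_eq (-v) two_pos
      have hsq : HasSubexponentialGrowth fun z => φ (-v * z ^ 2) := by
        have := (hasSubexponentialGrowth_comp_sq hφ hord).comp_mul k
        simpa only [mul_pow, hk] using this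
      obtain ⟨t, ht, hw⟩ := exists_one_lt_norm_of_neg (f := fun z => φ (-v * z)) (by fun_prop) hsq (by
          rintro ⟨c, hc⟩
          exact hnc ⟨c, fun z => by simpa [hv0] using hc (-v⁻¹ * z)⟩)
      have hw' : 1 < ‖φ (t * v)‖ := by
        have h1 : -v * -(t : ℂ) = t * v := by ring
        rwa [h1] at hw
      obtain ⟨δ, hδ, hlt⟩ := exists_forall_norm_lt_one (u := t * v) h0 hp hg.continuousAt heq (by
        have h1 : (t * v) ^ p * g 0 = ((-(t ^ p) : ℝ) : ℂ) := by
          rw [mul_pow, hv]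
          push_cast
          field_simp
        rw [h1, Complex.ofReal_re]
        exact neg_neg_of_pos (pow_pos ht p))
      exact supportsHypercyclicAlgebra_of_ray hφ hexp hm hw' hδ hlt
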